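/- Let $\mathbb{T}^2=\mathbb{R}^2/\mathbb{Z}^2$ be the flat torus with the metric induced by $dx^2+dy^2$. For $x\in\mathbb{T}^2$ let $\mathbb{T}^2_x$ denote the torus $\mathbb{T}^2$ with the points $[0]$ and $x$ marked (for $x=[0]$ only one point is marked). A saddle connection of $\mathbb{T}^2_x$ is a geodesic segment of positive length joining two (possibly equal) marked points with no marked point in its interior. A periodic cylinder of $\mathbb{T}^2_x$ is a connected component of the set of those points whose trajectory in some fixed direction is periodic and meets no marked point; its length is the common prime period of these trajectories. Both kinds of objects are counted without orientation. Let $N_{sc}(\mathbb{T}^2_x,T)$ and $N_{po}(\mathbb{T}^2_x,T)$ be the numbers of saddle connections and of periodic cylinders, respectively, of length less than $T$. Call $x$ rational if it is represented by a point of $\mathbb{Q}^2$, and non-rational otherwise. **Theorem.** The numbers $N_{sc}(\mathbb{T}^2_x,T)$, $N_{po}(\mathbb{T}^2_x,T)$ are finite, and for every $x\in\mathbb{T}^2$ the limits $$c_{sc}(x)=\lim_{T\to\infty}\frac{N_{sc}(\mathbb{T}^2_x,T)}{T^2},\qquad c_{po}(x)=\lim_{T\to\infty}\frac{N_{po}(\mathbb{T}^2_x,T)}{T^2}$$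 exist. Moreover: 1. If $x$ is non-rational, then $c_{sc}(x)=\frac{6}{\pi}+\pi$ and $c_{po}(x)=\frac{6}{\pi}$. 2. For all $x$ one has $c_{sc}(x)\le\frac{6}{\pi}+\pi$ and $c_{po}(x)\le\frac{6}{\pi}$, and both inequalities are strict if $x$ is rational. 3. If $x=\left[\frac{p_1}{n},\frac{p_2}{n}\right]$ with $n\ge 2$, $p_1,p_2\in\mathbb{Z}$ and $\gcd(p_1,p_2,n)=1$, then $$c_{sc}(x)=\frac{6}{\pi}\left(1+\prod_{p\mid n}\left(1-\frac{1}{p^2}\right)^{-1}\sum_{\substack{1\le i<n\\ \gcd(i,n)=1}}\left(\frac{1}{i^2}-\frac{1}{n^2}\right)\right) =\frac{6}{\pi}\left(1+\prod_{p\mid n}\left(1-\frac{1}{p^2}\right)^{-1}\left(\sum_{\substack{1\le i<n\\ \gcd(i,n)=1}}\frac{1}{i^2}-\frac{\varphi(n)}{n^2}\right)\right),$$ $$c_{po}(x)=\frac{6}{\pi}\left(1-\frac{1}{2n}\prod_{p\mid n}\left(1+\frac{1}{p}\right)^{-1}\right) =\frac{6}{\pi}\left(1-\frac{\varphi(n)}{2n^2}\prod_{p\mid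 n}\left(1-\frac{1}{p^2}\right)^{-1}\right),$$ where the products run over the primes $p$ dividing $n$ and $\varphi$ is Euler's function. 4. The functions $c_{sc}$ and $c_{po}$ are continuous at every non-rational point. In particular, if $(x_k)$ is a sequence of rational points converging to a non-rational point, then $c_{sc}(x_k)\to\frac{6}{\pi}+\pi$ and $c_{po}(x_k)\to\frac{6}{\pi}$. -/

import Mathlib

/-- The standard flat torus `ℝ² / ℤ²`. -/
abbrev Torus : Type := UnitAddTorus (Fin 2)

/-- The covering projection `ℝ² → ℝ² / ℤ²` from the Euclidean plane. -/
noncomputable def torusProj (v : EuclideanSpace ℝ (Fin 2)) : Torus :=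
  fun i => ((v i : ℝ) : UnitAddCircle)

/-- The unit speed geodesic of the flat torus (with respect to the metric `dx² + dy²`, when
`‖u‖ = 1`) which starts at `p` in direction `u`, at time `t`. -/
noncomputable def geodesic (p : Torus) (u : EuclideanSpace ℝ (Fin 2)) (t : ℝ) : Torus :=
  p + torusProj (t • u)

/-- A point of the torus is rational if it has a representative in `ℚ²`. -/
def IsRationalPoint (x : Torus) : Prop :=
  ∃ q₁ q₂ : ℚ, x = torusProj !₂[(q₁ : ℝ), (q₂ : ℝ)]

/-- `σ` is a saddle connection of length `ℓ` on the torus with set of marked points `S`: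
a geodesic segment of length `ℓ > 0` which joins two (not necessarily different) marked points
and has no marked point in its interior. It is recorded as a subset of the torus, so the two
orientations are not distinguished. -/
def IsSaddleConnection (S : Set Torus) (σ : Set Torus) (ℓ : ℝ) : Prop :=
  0 < ℓ ∧ ∃ (p : Torus) (u : EuclideanSpace ℝ (Fin 2)), ‖u‖ = 1 ∧
    p ∈ S ∧ geodesic p u ℓ ∈ S ∧ (∀ t ∈ Set.Ioo 0 ℓ, geodesic p u t ∉ S) ∧
    σ = geodesic p u '' Set.Icc 0 ℓ

/-- The points whose trajectory in direction `u` is periodic and meets no marked point. -/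
def periodicRegularPoints (S : Set Torus) (u : EuclideanSpace ℝ (Fin 2)) : Set Torus :=
  {y | (∃ ℓ : ℝ, 0 < ℓ ∧ geodesic y u ℓ = y) ∧ ∀ t : ℝ, geodesic y u t ∉ S}

/-- `C` is a (maximal) cylinder of periodic trajectories of length `ℓ` on the torus with set of
marked points `S`: for some direction `u` it is a connected component of the set of points whose
`u`-trajectory is periodic and avoids the marked points, and `ℓ` is the prime period of these
trajectories. It is recorded as a subset of the torus, so the two orientations are not
distinguished. -/
def IsPeriodicCylinder (S : Set Torus) (C : Set Torus) (ℓ : ℝ) : Prop :=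
  ∃ u : EuclideanSpace ℝ (Fin 2), ‖u‖ = 1 ∧
    (∃ y ∈ periodicRegularPoints S u, C = connectedComponentIn (periodicRegularPoints S u) y) ∧
    ∀ y ∈ C, IsLeast {r : ℝ | 0 < r ∧ geodesic y u r = y} ℓ

/-- The saddle connections of length less than `T` on the torus marked at `0` and `x`. -/
def saddleConnections (x : Torus) (T : ℝ) : Set (Set Torus) :=
  {σ | ∃ ℓ < T, IsSaddleConnection {0, x} σ ℓ}

/-- The cylinders of periodic trajectories of length less than `T` on the torus marked at `0`
and `x`. -/
def periodicCylinders (x : Torus) (T : ℝ) : Set (Set Torus) :=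
  {C | ∃ ℓ < T, IsPeriodicCylinder {0, x} C ℓ}

/-- The number of saddle connections of length less than `T`. -/
noncomputable def Nsc (x : Torus) (T : ℝ) : ℕ := (saddleConnections x T).ncard

/-- The number of cylinders of periodic trajectories of length less than `T`. -/
noncomputable def Npo (x : Torus) (T : ℝ) : ℕ := (periodicCylinders x T).ncard

/-! A closed direction on the torus is that of a primitive integer vector `v`, unique up to sign,
and all its leaves have length `‖intVec v‖`. These leaves are the fibres of the homomorphism
`transverse v` to the circle. Cutting along the leaves of `0` and `x` leaves two cylinders, or one
if both points lie on the same leaf (`v` is then aligned). A saddle connection is a closed loop at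
`0` or at `x` in a non-aligned direction, or an arc from `0` to `x`, which lifts to a vector `X + m`
unobstructed by marked points. Hence `Npo_eq` and `Nsc_eq`: if the aligned vectors, both signs
included, have density `a` and the unobstructed shifts have density `b`, the growth rates are `6/π -
a/2` for cylinders and `6/π - a + b` for saddle connections.

If `x` is non-rational, two independent aligned vectors would determine `x` as a rational solution
of a linear system. So there is at most one aligned direction, all obstructed shifts lie on one
line, and `a = 0`, `b = π` by the Gauss circle asymptotics.

If `x = [p/n]` with `p` unimodular modulo `n`, the aligned vectors are the primitive vectors in the
classes `k p` with `k` a unit (`aligned_torsion_eq`). The shift `m` is unobstructed exactly when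
`gcd(p + n m) < n` (`visible_torsion_iff`), and sorting by this gcd again leads to primitive vectors
in a residue class (`ncard_gcd_eq_fiber`). The density of such a class is found by Möbius inversion
(`ncard_primitive_residueClass_tendsto`).

The strict inequalities and the continuity come from `saddleRate_eq`: the deficit from `6/π + π` is
a tail of an Euler-factor-deprived `ζ(2)` plus a positive totient term, and it tends to `0` as `n`
grows. Near a non-rational point only large denominators occur. -/

open Filter Topology

/-! ### Dirichlet series over the integers coprime to `n` -/

/-- This is the L-series of the trivial character modulo `n` at `2`, that is `ζ(2)` with the Euler
factors at `p ∣ n` removed. -/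
lemma hasSum_coprime_one_div_sq (n : ℕ) [NeZero n] :
    HasSum (fun i : ℕ => if i.Coprime n then 1 / (i : ℝ) ^ 2 else 0)
      (Real.pi ^ 2 / 6 * ∏ p ∈ n.primeFactors, (1 - 1 / (p : ℝ) ^ 2)) := by
  have h2 : (1 : ℝ) < (2 : ℂ).re := by norm_num
  have hs := DirichletCharacter.LSeriesSummable_of_one_lt_re (1 : DirichletCharacter ℂ n) h2
  have key := (DirichletCharacter.LFunction_eq_LSeries (1 : DirichletCharacter ℂ n) h2).symm.trans
    (DirichletCharacter.LFunctionTrivChar_eq_mul_riemannZeta (N := n) (s := 2) (by norm_num))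
  have hsum := hs.hasSum
  change HasSum _ (LSeries _ 2) at hsum
  rw [key, riemannZeta_two] at hsum
  rw [← Complex.hasSum_ofReal]
  convert hsum using 1
  · ext i
    rcases eq_or_ne i 0 with rfl | hi
    · simp
    · rw [LSeries.term_of_ne_zero hi]
      by_cases hc : i.Coprime n
      · have hu := (ZMod.isUnit_iff_coprime i n).2 hc
        rw [if_pos hc]; simp [MulChar.one_apply hu]
      · have hu := mt (ZMod.isUnit_iff_coprime i n).1 hc
        rw [if_neg hc]; simp [MulChar.map_nonunit _ hu]
  · push_cast
    rw [mul_comm]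
    congr 1
    refine Finset.prod_congr rfl fun p _ => ?_
    rw [Complex.cpow_neg]
    norm_num

/-- Twisting by `μ` inverts the L-series of a character, so the value is the reciprocal of the
previous one. It is the arithmetic factor in `primitiveDensity`. -/
lemma hasSum_coprime_moebius_div_sq (n : ℕ) [NeZero n] :
    HasSum (fun i : ℕ => if i.Coprime n then (ArithmeticFunction.moebius i : ℝ) / (i : ℝ) ^ 2 else 0)
      (6 / Real.pi ^ 2 * (∏ p ∈ n.primeFactors, (1 - 1 / (p : ℝ) ^ 2))⁻¹) := by
  have h2 : (1 : ℝ) < (2 : ℂ).re := by norm_num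
  have hm := DirichletCharacter.LSeries.mul_mu_eq_one (1 : DirichletCharacter ℂ n) h2
  have key := (DirichletCharacter.LFunction_eq_LSeries (1 : DirichletCharacter ℂ n) h2).symm.trans
    (DirichletCharacter.LFunctionTrivChar_eq_mul_riemannZeta (N := n) (s := 2) (by norm_num))
  rw [key, riemannZeta_two] at hm
  have hs : LSeriesSummable ((fun k : ℕ => (1 : DirichletCharacter ℂ n) k) *
      fun k : ℕ => (ArithmeticFunction.moebius k : ℂ)) 2 :=
    DirichletCharacter.LSeriesSummable_mul _
      (ArithmeticFunction.LSeriesSummable_moebius_iff.2 h2)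
  have hsum := hs.hasSum
  change HasSum _ (LSeries _ 2) at hsum
  rw [eq_inv_of_mul_eq_one_right hm] at hsum
  rw [← Complex.hasSum_ofReal]
  convert hsum using 1
  · ext i
    rcases eq_or_ne i 0 with rfl | hi
    · simp
    · rw [LSeries.term_of_ne_zero hi]
      by_cases hc : i.Coprime n
      · have hu := (ZMod.isUnit_iff_coprime i n).2 hc
        rw [if_pos hc]; simp [MulChar.one_apply hu]
      · have hu := mt (ZMod.isUnit_iff_coprime i n).1 hc
        rw [if_neg hc]; simp [MulChar.map_nonunit _ hu]
  · push_cast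
    rw [mul_inv, mul_comm]
    congr 1
    · congr 1
      refine Finset.prod_congr rfl fun p _ => ?_
      rw [Complex.cpow_neg]
      norm_num
    · rw [inv_div]

/-! ### Lattice points in discs -/

/-- The integer vectors `m` for which the translate `m + y` has Euclidean norm less than `R`. -/
def latticeDisc (y : ℝ × ℝ) (R : ℝ) : Set (ℤ × ℤ) :=
  {m | (m.1 + y.1) ^ 2 + (m.2 + y.2) ^ 2 < R ^ 2}

lemma latticeDisc_subset (y : ℝ × ℝ) (R : ℝ) :
    latticeDisc y R ⊆ (Finset.Icc (⌈-|R| - y.1⌉) (⌊|R| - y.1⌋) ×ˢ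
      Finset.Icc (⌈-|R| - y.2⌉) (⌊|R| - y.2⌋) : Finset (ℤ × ℤ)) := by
  rintro ⟨a, b⟩ h
  simp only [latticeDisc, Set.mem_ofPred_eq] at h
  have h1 : |(a : ℝ) + y.1| ≤ |R| := sq_le_sq.1 (by nlinarith [sq_nonneg ((b : ℝ) + y.2)])
  have h2 : |(b : ℝ) + y.2| ≤ |R| := sq_le_sq.1 (by nlinarith [sq_nonneg ((a : ℝ) + y.1)])
  rw [abs_le] at h1 h2
  simp only [Finset.coe_product, Finset.coe_Icc, Set.mem_prod, Set.mem_Icc, Int.ceil_le,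
    Int.le_floor]
  refine ⟨⟨?_, ?_⟩, ?_, ?_⟩ <;> linarith

lemma latticeDisc_finite (y : ℝ × ℝ) (R : ℝ) : (latticeDisc y R).Finite :=
  (Finset.finite_toSet _).subset (latticeDisc_subset y R)

/-- Triangle inequality in squared form; the mixed term is bounded by Cauchy–Schwarz through
Lagrange's identity. -/
lemma sq_add_sq_lt_of_add {a b c d r s : ℝ} (hs : 0 ≤ s) (hr : 0 ≤ r)
    (h : a ^ 2 + b ^ 2 < r ^ 2) (h' : c ^ 2 + d ^ 2 ≤ s ^ 2) :
    (a + c) ^ 2 + (b + d) ^ 2 < (r + s) ^ 2 := by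
  have h3 : a * c + b * d ≤ r * s := by
    refine abs_le_of_sq_le_sq' ?_ (by positivity) |>.2
    nlinarith [sq_nonneg (a * d - b * c), mul_le_mul h.le h' (by positivity) (by positivity)]
  nlinarith

/-- The number of lattice points in dilates of a bounded set with null frontier grows like its
volume; a convex set has null frontier. -/
lemma ncard_latticeDisc_zero_tendsto :
    Tendsto (fun R : ℝ => ((latticeDisc 0 R).ncard : ℝ) / R ^ 2) atTop (𝓝 Real.pi) := by
  set s : Set (Fin 2 → ℝ) := (WithLp.toLp 2) ⁻¹' (Metric.ball (0 : EuclideanSpace ℝ (Fin 2)) 1)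
    with hs
  have hmem : ∀ v, v ∈ s ↔ v 0 ^ 2 + v 1 ^ 2 < 1 := by
    intro v
    simp [hs, EuclideanSpace.norm_eq, Real.sqrt_lt' zero_lt_one]
  have hopen : IsOpen s := (Metric.isOpen_ball).preimage (PiLp.continuous_toLp 2 _)
  have hconv : Convex ℝ s := (convex_ball (0 : EuclideanSpace ℝ (Fin 2)) 1).is_linear_preimage
    (f := WithLp.toLp 2) ⟨fun _ _ => rfl, fun _ _ => rfl⟩
  have hbdd : Bornology.IsBounded s := by
    refine (Metric.isBounded_closedBall (x := (0 : Fin 2 → ℝ)) (r := 1)).subset fun v hv => ?_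
    rw [hmem] at hv
    rw [mem_closedBall_zero_iff, pi_norm_le_iff_of_nonneg zero_le_one]
    intro i
    rw [Real.norm_eq_abs, ← sq_le_one_iff_abs_le_one]
    fin_cases i
    · simp only [Fin.zero_eta]; nlinarith [sq_nonneg (v 1)]
    · simp only [Fin.mk_one]; nlinarith [sq_nonneg (v 0)]
  have hvol : MeasureTheory.volume.real s = Real.pi := by
    have h := (EuclideanSpace.volume_preserving_symm_measurableEquiv_toLp (Fin 2)).symm.measure_preimage
      (s := Metric.ball (0 : EuclideanSpace ℝ (Fin 2)) 1) Metric.isOpen_ball.measurableSet.nullMeasurableSet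
    rw [MeasureTheory.Measure.real, hs]
    erw [h]
    rw [EuclideanSpace.volume_ball]
    have : Real.Gamma (1 + 1) = 1 := by norm_num [Real.Gamma_two]
    simp [Real.sq_sqrt Real.pi_pos.le, Real.pi_pos.le, this]
  have key := tendsto_card_div_pow_atTop_volume' s hbdd hopen.measurableSet
    (hconv.addHaar_frontier MeasureTheory.volume) ?_
  · rw [hvol] at key
    refine key.congr' ?_
    filter_upwards [eventually_gt_atTop 0] with R hR
    rw [Fintype.card_fin]
    congr 2
    rw [← Nat.card_coe_set_eq]
    refine Nat.card_congr (Equiv.symm ?_)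
    -- The general theorem counts points of `R⁻¹ ℤ²` in the fixed unit disc; scaling by `R⁻¹`
    -- identifies them with the integer points in the disc of radius `R`.
    refine Equiv.ofBijective (fun m : latticeDisc 0 R => ⟨R⁻¹ • ![(m.1.1 : ℝ), m.1.2], ?_, ?_⟩) ⟨?_, ?_⟩
    · have := m.2
      simp only [latticeDisc, Set.mem_ofPred_eq, Prod.fst_zero, Prod.snd_zero, add_zero] at this
      rw [hmem]
      simp only [Pi.smul_apply, smul_eq_mul, Matrix.cons_val_zero, Matrix.cons_val_one, mul_pow]
      rw [← mul_add, inv_pow, inv_mul_lt_iff₀ (by positivity), mul_one]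
      exact this
    · refine Set.smul_mem_smul_set ?_
      rw [SetLike.mem_coe, Module.Basis.mem_span_iff_repr_mem]
      intro i
      fin_cases i <;> simp
    · rintro ⟨⟨a, b⟩, h1⟩ ⟨⟨c, d⟩, h2⟩ h
      have h' := congrArg Subtype.val h
      have h3 := smul_right_injective _ (inv_ne_zero hR.ne') h'
      have h4 := congrFun h3 0
      have h5 := congrFun h3 1
      simp at h4 h5
      simp [h4, h5]
    · rintro ⟨w, hw, hw2⟩
      obtain ⟨u, hu, rfl⟩ := hw2
      rw [SetLike.mem_coe, Module.Basis.mem_span_iff_repr_mem] at hu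
      obtain ⟨a, ha⟩ := hu 0
      obtain ⟨b, hb⟩ := hu 1
      simp at ha hb
      rw [hmem] at hw
      simp only [Pi.smul_apply, smul_eq_mul, mul_pow] at hw
      rw [← mul_add, inv_pow, inv_mul_lt_iff₀ (by positivity), mul_one, ← ha, ← hb] at hw
      refine ⟨⟨(a, b), by simpa [latticeDisc] using hw⟩, ?_⟩
      ext i
      fin_cases i <;> simp [ha, hb]
  -- The real-parameter form of the counting theorem asks that the dilates increase with the scale.
  · intro x y hx hxy v hv
    have hy : 0 < y := hx.trans_le hxy
    rw [Set.mem_smul_set_iff_inv_smul_mem₀ hx.ne', hmem] at hv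
    rw [Set.mem_smul_set_iff_inv_smul_mem₀ hy.ne', hmem]
    refine lt_of_le_of_lt ?_ hv
    simp only [Pi.smul_apply, smul_eq_mul]
    have : y⁻¹ ≤ x⁻¹ := inv_anti₀ hx hxy
    have h0 : 0 < y⁻¹ := by positivity
    rw [mul_pow, mul_pow, mul_pow, mul_pow]
    gcongr

/-- The shifted disc lies between the centred discs of radii `R - ‖y‖` and `R + ‖y‖`, which have the
same leading term. -/
lemma ncard_latticeDisc_tendsto (y : ℝ × ℝ) :
    Tendsto (fun R : ℝ => ((latticeDisc y R).ncard : ℝ) / R ^ 2) atTop (𝓝 Real.pi) := by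
  set r := Real.sqrt (y.1 ^ 2 + y.2 ^ 2)
  have hr0 : 0 ≤ r := Real.sqrt_nonneg _
  have hr : y.1 ^ 2 + y.2 ^ 2 ≤ r ^ 2 := (Real.sq_sqrt (by positivity)).ge
  have aux : ∀ c : ℝ, Tendsto (fun R : ℝ => ((latticeDisc 0 (R + c)).ncard : ℝ) / R ^ 2) atTop
      (𝓝 Real.pi) := by
    intro c
    have h1 := ncard_latticeDisc_zero_tendsto.comp (tendsto_atTop_add_const_right atTop c tendsto_id)
    have h2 : Tendsto (fun R : ℝ => ((R + c) / R) ^ 2) atTop (𝓝 1) := by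
      have h3 : Tendsto (fun R : ℝ => 1 + c / R) atTop (𝓝 (1 + 0)) :=
        tendsto_const_nhds.add (tendsto_const_nhds.div_atTop tendsto_id)
      have h4 := h3.pow 2
      simp only [add_zero, one_pow] at h4
      refine h4.congr' ?_
      filter_upwards [eventually_gt_atTop 0] with R hR
      rw [add_div, div_self hR.ne']
    have h5 := h1.mul h2
    rw [mul_one] at h5
    refine h5.congr' ?_
    filter_upwards [eventually_gt_atTop 0, eventually_gt_atTop (-c)] with R hR hR2
    have : R + c ≠ 0 := by linarith
    simp only [Function.comp, id]
    field_simp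
  refine tendsto_of_tendsto_of_tendsto_of_le_of_le' (aux (-r)) (aux r) ?_ ?_
  · filter_upwards [eventually_gt_atTop r] with R hR
    gcongr
    · exact latticeDisc_finite _ _
    · intro m hm
      simp only [latticeDisc, Set.mem_ofPred_eq, Prod.fst_zero, Prod.snd_zero, add_zero] at hm ⊢
      have := sq_add_sq_lt_of_add hr0 (by linarith) hm hr
      simpa using this
  · filter_upwards [eventually_gt_atTop 0] with R hR
    gcongr
    · exact latticeDisc_finite _ _
    · intro m hm
      simp only [latticeDisc, Set.mem_ofPred_eq, Prod.fst_zero, Prod.snd_zero, add_zero] at hm ⊢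
      have := sq_add_sq_lt_of_add (c := -y.1) (d := -y.2) hr0 hR.le hm (by simpa using hr)
      simpa using this

/-! ### Density of primitive vectors in a residue class -/

/-- The integer vectors with coprime entries. -/
def primitiveVectors : Set (ℤ × ℤ) := {w | Int.gcd w.1 w.2 = 1}

/-- The integer vectors congruent to `c` modulo `n`. -/
def residueClass (n : ℕ) (c : ℤ × ℤ) : Set (ℤ × ℤ) :=
  {w | w.1 ≡ c.1 [ZMOD n] ∧ w.2 ≡ c.2 [ZMOD n]}

/-- The number of non-zero vectors of norm less than `R` in a residue class which are divisible
by `d`. -/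
noncomputable def divisibleCount (n : ℕ) (c : ℤ × ℤ) (d : ℕ) (R : ℝ) : ℕ :=
  (latticeDisc 0 R ∩ {w | w ≠ 0 ∧ (d : ℤ) ∣ w.1 ∧ (d : ℤ) ∣ w.2 ∧ w ∈ residueClass n c}).ncard

lemma mem_latticeDisc_zero {w : ℤ × ℤ} {R : ℝ} :
    w ∈ latticeDisc 0 R ↔ (w.1 : ℝ) ^ 2 + (w.2 : ℝ) ^ 2 < R ^ 2 := by
  simp [latticeDisc]

lemma le_of_dvd_of_mem_latticeDisc {w : ℤ × ℤ} {R : ℝ} (hR : 0 < R) (hw : w ∈ latticeDisc 0 R)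
    (h0 : w ≠ 0) {d : ℕ} (h1 : (d : ℤ) ∣ w.1) (h2 : (d : ℤ) ∣ w.2) : (d : ℝ) < R := by
  rw [mem_latticeDisc_zero] at hw
  have aux : ∀ a : ℤ, a ≠ 0 → (d : ℤ) ∣ a → (d : ℝ) ^ 2 ≤ (a : ℝ) ^ 2 := by
    intro a ha hd
    have := Int.le_of_dvd (abs_pos.2 ha) ((dvd_abs _ _).2 hd)
    rw [sq_le_sq, abs_of_nonneg (by positivity : (0 : ℝ) ≤ d)]
    exact_mod_cast this
  refine lt_of_pow_lt_pow_left₀ 2 hR.le (lt_of_le_of_lt ?_ hw)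
  by_cases h : w.1 = 0
  · have h' : w.2 ≠ 0 := fun h' => h0 (Prod.ext h h')
    nlinarith [aux _ h' h2, sq_nonneg (w.1 : ℝ)]
  · nlinarith [aux _ h h1, sq_nonneg (w.2 : ℝ)]

/-- This dominates the Möbius sum uniformly in `R`. Division by `d` maps the vectors injectively
into the box `[-k, k]²` with `k = ⌊R/d⌋`; for `k ≥ 1` one has `(2k+1)² ≤ (3R/d)²`, whence the `9`.
For `d ≥ R` only the zero vector could remain, and it is excluded from the count. -/
lemma divisibleCount_le (n : ℕ) (c : ℤ × ℤ) {d : ℕ} (hd : 0 < d) {R : ℝ} (hR : 0 < R) :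
    (divisibleCount n c d R : ℝ) ≤ 9 * R ^ 2 / (d : ℝ) ^ 2 := by
  have hd' : (0 : ℝ) < d := by exact_mod_cast hd
  by_cases hdR : (d : ℝ) < R
  · set k := ⌊R / d⌋
    have hk1 : 1 ≤ k := Int.le_floor.2 (by rw [Int.cast_one, one_le_div hd']; exact hdR.le)
    have hk : (k : ℝ) ≤ R / d := Int.floor_le _
    have hcard : divisibleCount n c d R ≤
        ((Finset.Icc (-k) k ×ˢ Finset.Icc (-k) k : Finset (ℤ × ℤ)) : Set (ℤ × ℤ)).ncard := by
      refine Set.ncard_le_ncard_of_injOn (fun w => (w.1 / d, w.2 / d)) ?_ ?_ (Finset.finite_toSet _)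
      · rintro ⟨a, b⟩ ⟨hw, _, ⟨a', ha⟩, ⟨b', hb⟩, _⟩
        simp only at ha hb
        subst ha hb
        have hdz : (d : ℤ) ≠ 0 := by exact_mod_cast hd.ne'
        rw [mem_latticeDisc_zero] at hw
        push_cast at hw
        have bound : ∀ x y : ℤ, ((d : ℝ) * x) ^ 2 + ((d : ℝ) * y) ^ 2 < R ^ 2 → |x| ≤ k := by
          intro x y h
          refine Int.le_floor.2 ?_
          rw [le_div_iff₀ hd', Int.cast_abs, ← abs_of_pos hd', ← abs_mul]
          refine abs_le_of_sq_le_sq (by nlinarith [sq_nonneg ((d : ℝ) * y)]) hR.le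
        have h1 := abs_le.1 (bound a' b' hw)
        have h2 := abs_le.1 (bound b' a' (by linarith))
        simp [Int.mul_ediv_cancel_left _ hdz, h1, h2]
      · rintro ⟨a, b⟩ ⟨_, _, ha, hb, _⟩ ⟨a', b'⟩ ⟨_, _, ha', hb', _⟩ h
        simp only [Prod.mk.injEq] at h ha hb ha' hb' ⊢
        exact ⟨(Int.ediv_left_inj ha ha').1 h.1, (Int.ediv_left_inj hb hb').1 h.2⟩
    have h2 : ((divisibleCount n c d R : ℕ) : ℝ) ≤ (2 * k + 1) ^ 2 := by
      refine (Nat.cast_le.2 hcard).trans (le_of_eq ?_)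
      rw [Set.ncard_coe_finset, Finset.card_product, Int.card_Icc, Nat.cast_mul, ← sq]
      congr 1
      have : ((k + 1 - -k).toNat : ℤ) = 2 * k + 1 := by rw [Int.toNat_of_nonneg] <;> linarith
      exact_mod_cast this
    have hk1' : (1 : ℝ) ≤ k := by exact_mod_cast hk1
    calc _ ≤ (2 * (k : ℝ) + 1) ^ 2 := h2
      _ ≤ (3 * (R / d)) ^ 2 := by gcongr; linarith
      _ = _ := by rw [mul_pow, div_pow]; ring
  · have : divisibleCount n c d R = 0 := by
      rw [divisibleCount, Set.ncard_eq_zero ((latticeDisc_finite _ _).inter_of_left _)]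
      refine Set.eq_empty_of_forall_notMem fun w ⟨hw, h0, h1, h2, _⟩ => hdR ?_
      exact le_of_dvd_of_mem_latticeDisc hR hw h0 h1 h2
    rw [this]
    push_cast
    positivity

/-- A common factor of `d` and `n` would divide the vector, hence `c`, contradicting the coprimality
of `c` with `n`. -/
lemma divisibleCount_eq_zero {n : ℕ} {c : ℤ × ℤ} (hc : Nat.gcd (Int.gcd c.1 c.2) n = 1) {d : ℕ}
    (hd : ¬ d.Coprime n) (R : ℝ) : divisibleCount n c d R = 0 := by
  rw [divisibleCount, Set.ncard_eq_zero ((latticeDisc_finite _ _).inter_of_left _)]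
  refine Set.eq_empty_of_forall_notMem fun w ⟨_, _, h1, h2, h3, h4⟩ => hd ?_
  have hg : ((Nat.gcd d n : ℕ) : ℤ) ∣ d := by exact_mod_cast Nat.gcd_dvd_left d n
  have hg' : ((Nat.gcd d n : ℕ) : ℤ) ∣ n := by exact_mod_cast Nat.gcd_dvd_right d n
  have hc1 := ((h3.of_dvd hg').dvd_iff).1 (hg.trans h1)
  have hc2 := ((h4.of_dvd hg').dvd_iff).1 (hg.trans h2)
  have := Nat.dvd_gcd (Int.dvd_gcd hc1 hc2) (Nat.gcd_dvd_right d n)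
  rw [hc] at this
  exact Nat.dvd_one.1 this

/-- With `k` an inverse of `d` modulo `n`, the vectors counted are `d (k c + n m)`, so `m` runs over
a shifted disc of radius `R / (d n)`. -/
lemma divisibleCount_tendsto {n : ℕ} (hn : 0 < n) (c : ℤ × ℤ) {d : ℕ} (hd0 : 0 < d)
    (hd : d.Coprime n) :
    Tendsto (fun R : ℝ => (divisibleCount n c d R : ℝ) / R ^ 2) atTop
      (𝓝 (Real.pi / (n ^ 2 * d ^ 2))) := by
  have hn' : (0 : ℝ) < n := by exact_mod_cast hn
  have hd' : (0 : ℝ) < d := by exact_mod_cast hd0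
  obtain ⟨k, hk⟩ : ∃ k : ℤ, d * k ≡ 1 [ZMOD n] :=
    Int.mod_coprime hd
  set e : ℤ × ℤ := (k * c.1, k * c.2)
  have he : ∀ z : ℤ, d * (k * z) ≡ z [ZMOD n] := fun z => by
    have := hk.mul_right z
    rwa [one_mul, mul_assoc] at this
  have hset : ∀ R : ℝ, (latticeDisc (((e.1 : ℝ) / n), ((e.2 : ℝ) / n)) (R / (d * n))).ncard =
      (latticeDisc 0 R ∩ {w | (d : ℤ) ∣ w.1 ∧ (d : ℤ) ∣ w.2 ∧ w ∈ residueClass n c}).ncard := by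
    intro R
    have hiff : ∀ a b : ℤ, ((a, b) ∈ latticeDisc (((e.1 : ℝ) / n), ((e.2 : ℝ) / n)) (R / (d * n)) ↔
        ((d * (e.1 + n * a), d * (e.2 + n * b)) : ℤ × ℤ) ∈ latticeDisc 0 R) := by
      intro a b
      rw [mem_latticeDisc_zero]
      simp only [latticeDisc, Set.mem_ofPred_eq]
      rw [div_pow, lt_div_iff₀ (by positivity)]
      push_cast
      have : ((a + (e.1 : ℝ) / n) ^ 2 + (b + (e.2 : ℝ) / n) ^ 2) * (d * n) ^ 2 =
        (d * (e.1 + n * a)) ^ 2 + (d * (e.2 + n * b)) ^ 2 := by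
        field_simp
        ring
      rw [this]
    have hcong : ∀ x y z : ℤ, d * (k * x + n * y) ≡ x [ZMOD n] := by
      intro x y z
      have h1 : d * (k * x + n * y) ≡ d * (k * x) [ZMOD n] := by
        refine (Int.modEq_iff_dvd.2 ⟨-(d * y), by ring⟩)
      exact h1.trans (he x)
    refine Set.ncard_congr (fun m _ => (d * (e.1 + n * m.1), d * (e.2 + n * m.2))) ?_ ?_ ?_
    · rintro ⟨a, b⟩ h
      exact ⟨(hiff a b).1 h, dvd_mul_right _ _, dvd_mul_right _ _, hcong _ _ 0, hcong _ _ 0⟩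
    · rintro ⟨a, b⟩ ⟨a', b'⟩ _ _ h
      have hdz : (d : ℤ) ≠ 0 := by exact_mod_cast hd0.ne'
      have hnz : (n : ℤ) ≠ 0 := by exact_mod_cast hn.ne'
      simpa [hd0.ne', hn.ne'] using h
    · rintro ⟨a, b⟩ ⟨h, ⟨a', ha⟩, ⟨b', hb⟩, h1, h2⟩
      simp only at ha hb h1 h2
      subst ha hb
      have hco : IsCoprime (n : ℤ) d := (Nat.isCoprime_iff_coprime.2 hd).symm
      have hx : ∀ x z : ℤ, d * x ≡ z [ZMOD n] → ∃ y : ℤ, x = k * z + n * y := by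
        intro x z hz
        have h3 := (he z).trans hz.symm
        obtain ⟨y, hy⟩ := hco.dvd_of_dvd_mul_left (y := (d : ℤ)) (z := x - k * z)
          (by rw [mul_sub]; exact Int.modEq_iff_dvd.1 h3)
        exact ⟨y, by linarith⟩
      obtain ⟨x, rfl⟩ := hx _ _ h1
      obtain ⟨y, rfl⟩ := hx _ _ h2
      exact ⟨(x, y), (hiff x y).2 h, rfl⟩
  have h1 : Tendsto (fun R : ℝ => ((latticeDisc (((e.1 : ℝ) / n), ((e.2 : ℝ) / n))
      (R / (d * n))).ncard : ℝ) / R ^ 2) atTop (𝓝 (Real.pi / (n ^ 2 * d ^ 2))) := by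
    have := ((ncard_latticeDisc_tendsto (((e.1 : ℝ) / n), ((e.2 : ℝ) / n))).comp
      (tendsto_id.atTop_div_const (by positivity : (0 : ℝ) < d * n))).div_const (n ^ 2 * d ^ 2)
    refine this.congr' ?_
    filter_upwards [eventually_gt_atTop 0] with R hR
    simp only [Function.comp, id]
    field_simp
  -- Leaving out the zero vector changes the count by at most one.
  have h2 : Tendsto (fun R : ℝ => 1 / R ^ 2) atTop (𝓝 0) :=
    tendsto_const_nhds.div_atTop (tendsto_pow_atTop two_ne_zero)
  have h3 := h1.sub h2
  rw [sub_zero] at h3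
  have hdiff : ∀ R : ℝ, latticeDisc 0 R ∩ {w | w ≠ 0 ∧ (d : ℤ) ∣ w.1 ∧ (d : ℤ) ∣ w.2 ∧
      w ∈ residueClass n c} = (latticeDisc 0 R ∩ {w | (d : ℤ) ∣ w.1 ∧ (d : ℤ) ∣ w.2 ∧
      w ∈ residueClass n c}) \ {0} := by
    intro R
    ext w
    simp only [Set.mem_inter_iff, Set.mem_ofPred_eq, Set.mem_sdiff, Set.mem_singleton_iff]
    tauto
  refine tendsto_of_tendsto_of_tendsto_of_le_of_le h3 h1 (fun R => ?_) (fun R => ?_)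
  · simp only
    rw [← sub_div, hset, divisibleCount, hdiff]
    gcongr
    rw [sub_le_iff_le_add]
    exact_mod_cast Set.pred_ncard_le_ncard_sdiff_singleton _ _ |> Nat.sub_le_iff_le_add.1
  · simp only
    rw [hset, divisibleCount, hdiff]
    gcongr
    · exact (latticeDisc_finite _ _).inter_of_left _
    · exact Set.sdiff_subset

/-- Möbius inversion: `∑ μ(d)` over `d ∣ gcd w` is the indicator of `gcd w = 1`. The sum is finite
since a non-zero vector divisible by `d` has norm at least `d`. -/
lemma ncard_primitive_eq_tsum (n : ℕ) (c : ℤ × ℤ) {R : ℝ} (hR : 0 < R) :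
    ((latticeDisc 0 R ∩ (primitiveVectors ∩ residueClass n c)).ncard : ℝ) =
      ∑' d : ℕ, (ArithmeticFunction.moebius d : ℝ) * divisibleCount n c d R := by
  classical
  set M := ⌈R⌉₊
  set F := ((latticeDisc_finite 0 R).inter_of_left {w | w ≠ 0 ∧ w ∈ residueClass n c}).toFinset
  have hF : ∀ w, w ∈ F ↔ w ∈ latticeDisc 0 R ∧ w ≠ 0 ∧ w ∈ residueClass n c := by
    intro w; simp [F]
  have hlt : ∀ w ∈ F, ∀ d : ℕ, (d : ℤ) ∣ w.1 → (d : ℤ) ∣ w.2 → d ≤ M := by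
    intro w hw d h1 h2
    rw [hF] at hw
    have := le_of_dvd_of_mem_latticeDisc hR hw.1 hw.2.1 h1 h2
    exact_mod_cast this.le.trans (Nat.le_ceil R)
  have hcount : ∀ d : ℕ, divisibleCount n c d R =
      ∑ w ∈ F, if (d : ℤ) ∣ w.1 ∧ (d : ℤ) ∣ w.2 then 1 else 0 := by
    intro d
    rw [Finset.sum_boole, divisibleCount, Nat.cast_id, ← Set.ncard_coe_finset]
    congr 1
    ext w
    simp only [Set.mem_inter_iff, Set.mem_ofPred_eq, Finset.coe_filter, hF]
    tauto
  have hprim : (latticeDisc 0 R ∩ (primitiveVectors ∩ residueClass n c)).ncard =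
      ∑ w ∈ F, if Int.gcd w.1 w.2 = 1 then 1 else 0 := by
    rw [Finset.sum_boole, Nat.cast_id, ← Set.ncard_coe_finset]
    congr 1
    ext w
    simp only [Set.mem_inter_iff, Set.mem_ofPred_eq, Finset.coe_filter, hF, primitiveVectors]
    constructor
    · rintro ⟨h1, h2, h3⟩
      refine ⟨⟨h1, ?_, h3⟩, h2⟩
      rintro rfl
      simp at h2
    · tauto
  rw [tsum_eq_sum (s := Finset.Icc 1 M), hprim]
  · simp_rw [hcount]
    push_cast
    simp_rw [Finset.mul_sum]
    rw [Finset.sum_comm]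
    refine Finset.sum_congr rfl fun w hw => ?_
    have hw' := (hF w).1 hw
    have hg : Int.gcd w.1 w.2 ≠ 0 := by
      intro h
      rw [Int.gcd_eq_zero_iff] at h
      exact hw'.2.1 (Prod.ext h.1 h.2)
    have hdiv : (Finset.Icc 1 M).filter (fun d : ℕ => (d : ℤ) ∣ w.1 ∧ (d : ℤ) ∣ w.2) =
        (Int.gcd w.1 w.2).divisors := by
      ext d
      simp only [Finset.mem_filter, Finset.mem_Icc, Nat.mem_divisors]
      constructor
      · rintro ⟨_, h1, h2⟩
        exact ⟨Int.natCast_dvd_natCast.1 (Int.dvd_coe_gcd h1 h2), hg⟩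
      · rintro ⟨h, _⟩
        have h1 : (d : ℤ) ∣ w.1 := (Int.natCast_dvd_natCast.2 h).trans (Int.gcd_dvd_left ..)
        have h2 : (d : ℤ) ∣ w.2 := (Int.natCast_dvd_natCast.2 h).trans (Int.gcd_dvd_right ..)
        exact ⟨⟨Nat.pos_of_dvd_of_pos h (Nat.pos_of_ne_zero hg), hlt w hw d h1 h2⟩, h1, h2⟩
    simp_rw [mul_ite, mul_one, mul_zero]
    rw [← Finset.sum_filter, hdiv]
    rw [← Int.cast_sum, ← ArithmeticFunction.coe_mul_zeta_apply,
      ArithmeticFunction.moebius_mul_coe_zeta, ArithmeticFunction.one_apply]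
    push_cast
    rfl
  · intro d hd
    rw [Finset.mem_Icc, not_and_or, not_le, not_le] at hd
    rcases hd with hd | hd
    · rw [Nat.lt_one_iff.1 hd]; simp
    · have : divisibleCount n c d R = 0 := by
        rw [hcount]
        refine Finset.sum_eq_zero fun w hw => if_neg fun h => ?_
        exact absurd (hlt w hw d h.1 h.2) (not_le.2 hd)
      rw [this]; simp

/-- The density of the primitive vectors in a residue class modulo `n`. -/
noncomputable def primitiveDensity (n : ℕ) : ℝ :=
  6 / Real.pi / (n : ℝ) ^ 2 * (∏ p ∈ n.primeFactors, (1 - 1 / (p : ℝ) ^ 2))⁻¹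

/-- The Möbius sum is divided by `R²` and the limit is taken term by term, with dominating series `9
/ d²`. Only the `d` coprime to `n` survive. -/
lemma ncard_primitive_residueClass_tendsto {n : ℕ} (hn : 0 < n) {c : ℤ × ℤ}
    (hc : Nat.gcd (Int.gcd c.1 c.2) n = 1) :
    Tendsto (fun R : ℝ =>
      ((latticeDisc 0 R ∩ (primitiveVectors ∩ residueClass n c)).ncard : ℝ) / R ^ 2) atTop
      (𝓝 (primitiveDensity n)) := by
  have : NeZero n := ⟨hn.ne'⟩
  have hpi := Real.pi_ne_zero
  have hsum := (hasSum_coprime_moebius_div_sq n).mul_left (Real.pi / n ^ 2)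
  have hval : Real.pi / n ^ 2 * (6 / Real.pi ^ 2 *
      (∏ p ∈ n.primeFactors, (1 - 1 / (p : ℝ) ^ 2))⁻¹) = primitiveDensity n := by
    rw [primitiveDensity, ← mul_assoc]
    congr 1
    field_simp
  rw [hval] at hsum
  rw [← hsum.tsum_eq]
  have hlim := tendsto_tsum_of_dominated_convergence (𝓕 := atTop)
    (f := fun (R : ℝ) (d : ℕ) =>
      (ArithmeticFunction.moebius d : ℝ) * (divisibleCount n c d R / R ^ 2))
    (g := fun d : ℕ => Real.pi / n ^ 2 *
      if d.Coprime n then (ArithmeticFunction.moebius d : ℝ) / (d : ℝ) ^ 2 else 0)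
    (bound := fun d : ℕ => 9 * (1 / (d : ℝ) ^ 2))
    ((Real.summable_one_div_nat_pow.2 one_lt_two).mul_left 9) ?_ ?_
  · refine hlim.congr' ?_
    filter_upwards [eventually_gt_atTop 0] with R hR
    rw [ncard_primitive_eq_tsum n c hR, ← tsum_div_const]
    exact tsum_congr fun d => by ring
  · intro d
    rcases Nat.eq_zero_or_pos d with rfl | hd
    · simp
    by_cases hco : d.Coprime n
    · rw [if_pos hco]
      have := (divisibleCount_tendsto hn c hd hco).const_mul (ArithmeticFunction.moebius d : ℝ)
      convert this using 2
      field_simp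
    · rw [if_neg hco]
      simp [divisibleCount_eq_zero hc hco]
  · filter_upwards [eventually_gt_atTop 0] with R hR d
    rcases Nat.eq_zero_or_pos d with rfl | hd
    · simp
    rw [norm_mul, Real.norm_eq_abs, Real.norm_of_nonneg (by positivity)]
    have h1 : |(ArithmeticFunction.moebius d : ℝ)| ≤ 1 := by
      exact_mod_cast ArithmeticFunction.abs_moebius_le_one
    have h2 : (divisibleCount n c d R : ℝ) / R ^ 2 ≤ 9 * (1 / (d : ℝ) ^ 2) := by
      rw [div_le_iff₀ (by positivity)]
      refine (divisibleCount_le n c hd hR).trans (le_of_eq (by ring))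
    calc _ ≤ 1 * ((divisibleCount n c d R : ℝ) / R ^ 2) := by gcongr
      _ ≤ _ := by rw [one_mul]; exact h2

lemma ncard_primitive_tendsto :
    Tendsto (fun R : ℝ => ((latticeDisc 0 R ∩ primitiveVectors).ncard : ℝ) / R ^ 2) atTop
      (𝓝 (6 / Real.pi)) := by
  have h := ncard_primitive_residueClass_tendsto (n := 1) one_pos (c := (0, 0)) (by simp)
  have h1 : residueClass 1 (0, 0) = Set.univ := by
    ext w; simp [residueClass, Int.modEq_one]
  simpa [h1, primitiveDensity] using h

/-! ### The covering of the torus by the plane -/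

lemma unitAddCircle_coe_eq_zero_iff {s : ℝ} : ((s : ℝ) : UnitAddCircle) = 0 ↔ ∃ k : ℤ, s = k := by
  rw [AddCircle.coe_eq_zero_iff]
  simp [eq_comm]

/-- The integer vectors as elements of the Euclidean plane. -/
noncomputable def intVec (m : ℤ × ℤ) : EuclideanSpace ℝ (Fin 2) := !₂[(m.1 : ℝ), (m.2 : ℝ)]

@[simp] lemma intVec_apply_zero (m : ℤ × ℤ) : intVec m 0 = m.1 := rfl
@[simp] lemma intVec_apply_one (m : ℤ × ℤ) : intVec m 1 = m.2 := rfl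

lemma plane_ext {v w : EuclideanSpace ℝ (Fin 2)} (h0 : v 0 = w 0) (h1 : v 1 = w 1) : v = w := by
  ext i
  fin_cases i
  · exact h0
  · exact h1

lemma norm_sq_eq (v : EuclideanSpace ℝ (Fin 2)) : ‖v‖ ^ 2 = v 0 ^ 2 + v 1 ^ 2 := by
  rw [EuclideanSpace.norm_sq_eq]
  simp

lemma norm_lt_iff_sq {v : EuclideanSpace ℝ (Fin 2)} {T : ℝ} (hT : 0 < T) :
    ‖v‖ < T ↔ v 0 ^ 2 + v 1 ^ 2 < T ^ 2 := by
  rw [← norm_sq_eq, sq_lt_sq₀ (norm_nonneg v) hT.le]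

lemma intVec_neg (m : ℤ × ℤ) : intVec (-m) = -intVec m := by
  apply plane_ext <;> simp

lemma intVec_injective : Function.Injective intVec := by
  intro m m' h
  have h0 := congrArg (fun v : EuclideanSpace ℝ (Fin 2) => v 0) h
  have h1 := congrArg (fun v : EuclideanSpace ℝ (Fin 2) => v 1) h
  simp at h0 h1
  exact Prod.ext h0 h1

@[simp] lemma torusProj_apply (v : EuclideanSpace ℝ (Fin 2)) (i : Fin 2) :
    torusProj v i = ((v i : ℝ) : UnitAddCircle) := rfl

lemma torusProj_add (v w : EuclideanSpace ℝ (Fin 2)) :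
    torusProj (v + w) = torusProj v + torusProj w := by
  ext i; simp

lemma torusProj_neg (v : EuclideanSpace ℝ (Fin 2)) : torusProj (-v) = -torusProj v := by
  ext i; simp

lemma torusProj_sub (v w : EuclideanSpace ℝ (Fin 2)) :
    torusProj (v - w) = torusProj v - torusProj w := by
  ext i; simp

@[simp] lemma torusProj_zero : torusProj 0 = 0 := by
  ext i; simp

lemma continuous_torusProj : Continuous torusProj := by
  refine continuous_pi fun i => ?_
  exact (AddCircle.continuous_mk' 1).comp (by fun_prop)

lemma torusProj_surjective : Function.Surjective torusProj := by
  intro x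
  obtain ⟨a, ha⟩ := QuotientAddGroup.mk_surjective (x 0)
  obtain ⟨b, hb⟩ := QuotientAddGroup.mk_surjective (x 1)
  refine ⟨!₂[a, b], ?_⟩
  ext i
  fin_cases i
  · exact ha
  · exact hb

lemma torusProj_eq_zero_iff {v : EuclideanSpace ℝ (Fin 2)} :
    torusProj v = 0 ↔ ∃ m : ℤ × ℤ, v = intVec m := by
  constructor
  · intro h
    obtain ⟨a, ha⟩ := unitAddCircle_coe_eq_zero_iff.1 (congrFun h 0)
    obtain ⟨b, hb⟩ := unitAddCircle_coe_eq_zero_iff.1 (congrFun h 1)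
    exact ⟨(a, b), plane_ext ha hb⟩
  · rintro ⟨m, rfl⟩
    ext i
    fin_cases i
    · exact unitAddCircle_coe_eq_zero_iff.2 ⟨m.1, rfl⟩
    · exact unitAddCircle_coe_eq_zero_iff.2 ⟨m.2, rfl⟩

@[simp] lemma torusProj_intVec (m : ℤ × ℤ) : torusProj (intVec m) = 0 :=
  torusProj_eq_zero_iff.2 ⟨m, rfl⟩

lemma torusProj_eq_iff {v w : EuclideanSpace ℝ (Fin 2)} :
    torusProj v = torusProj w ↔ ∃ m : ℤ × ℤ, v = w + intVec m := by
  rw [← sub_eq_zero, ← torusProj_sub, torusProj_eq_zero_iff]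
  simp only [sub_eq_iff_eq_add']

/-! ### Closed leaves as fibres of the transverse coordinate -/

/-- The coordinate of the torus transverse to the direction of an integer vector. -/
noncomputable def transverse (v : ℤ × ℤ) : Torus →+ UnitAddCircle where
  toFun y := v.1 • y 1 - v.2 • y 0
  map_zero' := by simp
  map_add' y z := by simp only [Pi.add_apply, smul_add]; abel

lemma transverse_torusProj (v : ℤ × ℤ) (V : EuclideanSpace ℝ (Fin 2)) :
    transverse v (torusProj V) = ((v.1 * V 1 - v.2 * V 0 : ℝ) : UnitAddCircle) := by
  simp only [transverse, AddMonoidHom.coe_mk, ZeroHom.coe_mk, torusProj_apply]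
  rw [← AddCircle.coe_zsmul, ← AddCircle.coe_zsmul, ← AddCircle.coe_sub]
  simp

lemma continuous_transverse (v : ℤ × ℤ) : Continuous (transverse v) := by
  change Continuous fun y : Torus => v.1 • y 1 - v.2 • y 0
  fun_prop

lemma transverse_neg (v : ℤ × ℤ) (y : Torus) : transverse (-v) y = -transverse v y := by
  simp [transverse]; abel

lemma transverse_smul_intVec (v : ℤ × ℤ) (s : ℝ) : transverse v (torusProj (s • intVec v)) = 0 := by
  rw [transverse_torusProj]
  simp only [PiLp.smul_apply, intVec_apply_one, intVec_apply_zero, smul_eq_mul]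
  rw [show (v.1 : ℝ) * (s * v.2) - v.2 * (s * v.1) = 0 by ring]
  simp

lemma exists_bezout {v : ℤ × ℤ} (hv : v ∈ primitiveVectors) : ∃ α β : ℤ, α * v.1 + β * v.2 = 1 :=
  Int.isCoprime_iff_gcd_eq_one.2 hv

lemma exists_bezout_real {v : ℤ × ℤ} (hv : v ∈ primitiveVectors) :
    ∃ α β : ℤ, (α * v.1 + β * v.2 : ℝ) = 1 := by
  obtain ⟨α, β, h⟩ := exists_bezout hv
  exact ⟨α, β, by exact_mod_cast h⟩

/-- Primitivity of `v` is what makes the kernel a single leaf: a Bézout relation completes `v` to a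
basis of `ℤ²`. -/
lemma transverse_eq_zero_iff {v : ℤ × ℤ} (hv : v ∈ primitiveVectors) {y : Torus} :
    transverse v y = 0 ↔ ∃ s : ℝ, y = torusProj (s • intVec v) := by
  constructor
  · intro h
    obtain ⟨V, rfl⟩ := torusProj_surjective y
    rw [transverse_torusProj, unitAddCircle_coe_eq_zero_iff] at h
    obtain ⟨k, hk⟩ := h
    obtain ⟨α, β, hab⟩ := exists_bezout_real hv
    -- The vector `(-β, α)` has transverse coordinate `1`, so subtracting `k (-β, α)` from the lift
    -- `V` puts it on the line of `v`.
    refine ⟨α * V 0 + β * V 1, torusProj_eq_iff.2 ⟨(-β * k, α * k), plane_ext ?_ ?_⟩⟩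
    · simp
      rw [← hk]
      linear_combination -(V 0) * hab
    · simp
      rw [← hk]
      linear_combination -(V 1) * hab
  · rintro ⟨s, rfl⟩
    exact transverse_smul_intVec v s

lemma torusProj_smul_intVec_eq_zero_iff {v : ℤ × ℤ} (hv : v ∈ primitiveVectors) {s : ℝ} :
    torusProj (s • intVec v) = 0 ↔ ∃ k : ℤ, s = k := by
  rw [torusProj_eq_zero_iff]
  constructor
  · rintro ⟨m, hm⟩
    have h0 := congrArg (fun v : EuclideanSpace ℝ (Fin 2) => v 0) hm
    have h1 := congrArg (fun v : EuclideanSpace ℝ (Fin 2) => v 1) hm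
    simp at h0 h1
    obtain ⟨α, β, hab⟩ := exists_bezout_real hv
    refine ⟨α * m.1 + β * m.2, ?_⟩
    push_cast
    rw [← h0, ← h1]
    linear_combination -s * hab
  · rintro ⟨k, rfl⟩
    exact ⟨(k * v.1, k * v.2), plane_ext (by simp) (by simp)⟩

/-- Bézout for `v` gives `w = s v` with `s` an integer, and primitivity of `w` forces `|s| = 1`. -/
lemma eq_or_eq_neg_of_parallel {v w : ℤ × ℤ} (hv : v ∈ primitiveVectors) (hw : w ∈ primitiveVectors)
    (h : v.1 * w.2 = v.2 * w.1) : w = v ∨ w = -v := by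
  obtain ⟨α, β, hab⟩ := exists_bezout hv
  set s := α * w.1 + β * w.2 with hs
  have h1 : w.1 = s * v.1 := by rw [hs]; linear_combination -w.1 * hab - β * h
  have h2 : w.2 = s * v.2 := by rw [hs]; linear_combination -w.2 * hab + α * h
  have hw' : Int.gcd w.1 w.2 = 1 := hw
  have hv' : Int.gcd v.1 v.2 = 1 := hv
  rw [h1, h2, Int.gcd_mul_left, hv', mul_one] at hw'
  rcases Int.natAbs_eq_iff.1 hw' with h | h
  · left; ext <;> simp [h1, h2, h]
  · right; ext <;> simp [h1, h2, h]

lemma primitiveVectors_ne_zero {v : ℤ × ℤ} (hv : v ∈ primitiveVectors) : v ≠ 0 := by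
  rintro rfl
  simp [primitiveVectors] at hv

lemma neg_mem_primitiveVectors {v : ℤ × ℤ} (hv : v ∈ primitiveVectors) :
    -v ∈ primitiveVectors := by
  simpa [primitiveVectors] using hv

lemma intVec_ne_zero {v : ℤ × ℤ} (hv : v ≠ 0) : intVec v ≠ 0 := by
  intro h
  refine hv (intVec_injective ?_)
  rw [h]; apply plane_ext <;> simp

lemma exists_primitive_smul {m : ℤ × ℤ} (hm : m ≠ 0) :
    ∃ v ∈ primitiveVectors, ∃ g : ℕ, 0 < g ∧ m = ((g : ℤ) * v.1, (g : ℤ) * v.2) := by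
  have hg : 0 < Int.gcd m.1 m.2 := by
    rw [Int.gcd_pos_iff]
    by_contra! h
    exact hm (Prod.ext h.1 h.2)
  refine ⟨(m.1 / Int.gcd m.1 m.2, m.2 / Int.gcd m.1 m.2), Int.gcd_div_gcd_div_gcd hg,
    Int.gcd m.1 m.2, hg, ?_⟩
  ext
  · exact (Int.mul_ediv_cancel' (Int.gcd_dvd_left ..)).symm
  · exact (Int.mul_ediv_cancel' (Int.gcd_dvd_right ..)).symm

/-! ### Primitive vectors up to sign -/

/-- Representatives of the primitive vectors up to sign. -/
def positivePrimitiveVectors : Set (ℤ × ℤ) :=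
  {v | v ∈ primitiveVectors ∧ (0 < v.1 ∨ v.1 = 0 ∧ 0 < v.2)}

lemma positivePrimitiveVectors_subset : positivePrimitiveVectors ⊆ primitiveVectors :=
  fun _ h => h.1

lemma mem_or_neg_mem_positivePrimitiveVectors {v : ℤ × ℤ} (hv : v ∈ primitiveVectors) :
    v ∈ positivePrimitiveVectors ∨ -v ∈ positivePrimitiveVectors := by
  have hv' := neg_mem_primitiveVectors hv
  have h0 : ¬ (v.1 = 0 ∧ v.2 = 0) := fun h => primitiveVectors_ne_zero hv (Prod.ext h.1 h.2)
  simp only [positivePrimitiveVectors, Set.mem_ofPred_eq, hv, hv', true_and, Prod.fst_neg,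
    Prod.snd_neg]
  omega

lemma neg_notMem_positivePrimitiveVectors {v : ℤ × ℤ} (hv : v ∈ positivePrimitiveVectors) :
    -v ∉ positivePrimitiveVectors := by
  rintro ⟨_, h⟩
  have := hv.2
  simp only [Prod.fst_neg, Prod.snd_neg] at h
  omega

lemma eq_of_parallel_of_mem_positive {v w : ℤ × ℤ} (hv : v ∈ positivePrimitiveVectors)
    (hw : w ∈ positivePrimitiveVectors) (h : v.1 * w.2 = v.2 * w.1) : v = w := by
  rcases eq_or_eq_neg_of_parallel hv.1 hw.1 h with h | h
  · exact h.symm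
  · subst h
    exact absurd hw (neg_notMem_positivePrimitiveVectors hv)

lemma ncard_eq_two_mul_ncard_positive {Q : Set (ℤ × ℤ)} (hfin : Q.Finite)
    (hQ : Q ⊆ primitiveVectors) (hneg : ∀ v ∈ Q, -v ∈ Q) :
    Q.ncard = 2 * (Q ∩ positivePrimitiveVectors).ncard := by
  have h1 : Q = (Q ∩ positivePrimitiveVectors) ∪ Neg.neg '' (Q ∩ positivePrimitiveVectors) := by
    ext v
    constructor
    · intro hv
      rcases mem_or_neg_mem_positivePrimitiveVectors (hQ hv) with h | h
      · exact Or.inl ⟨hv, h⟩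
      · exact Or.inr ⟨-v, ⟨hneg v hv, h⟩, neg_neg v⟩
    · rintro (h | ⟨w, h, rfl⟩)
      · exact h.1
      · exact hneg _ h.1
  have hdisj : Disjoint (Q ∩ positivePrimitiveVectors)
      (Neg.neg '' (Q ∩ positivePrimitiveVectors)) := by
    rw [Set.disjoint_left]
    rintro _ h ⟨w, hw, rfl⟩
    exact neg_notMem_positivePrimitiveVectors hw.2 h.2
  have hf := hfin.inter_of_left positivePrimitiveVectors
  conv_lhs => rw [h1, Set.ncard_union_eq hdisj hf (hf.image _)]
  rw [Set.ncard_image_of_injective _ neg_injective, two_mul]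

/-! ### Periodic directions -/

lemma geodesic_eq_self_iff {y : Torus} {u : EuclideanSpace ℝ (Fin 2)} {r : ℝ} :
    geodesic y u r = y ↔ torusProj (r • u) = 0 := by
  simp [geodesic]

/-- A period `ℓ` makes `ℓ • u` a non-zero integer vector; dividing it by its content gives `v`. -/
lemma exists_primitive_of_periodic {u : EuclideanSpace ℝ (Fin 2)} (hu : ‖u‖ = 1) {ℓ : ℝ}
    (hℓ : 0 < ℓ) (h : torusProj (ℓ • u) = 0) :
    ∃ v ∈ primitiveVectors, intVec v = ‖intVec v‖ • u := by
  obtain ⟨m, hm⟩ := torusProj_eq_zero_iff.1 h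
  have hm0 : m ≠ 0 := by
    rintro rfl
    have : ‖ℓ • u‖ = 0 := by
      rw [hm, norm_eq_zero]
      apply plane_ext <;> simp
    rw [norm_smul, hu, mul_one, norm_eq_zero] at this
    exact hℓ.ne' this
  obtain ⟨v, hv, g, hg, rfl⟩ := exists_primitive_smul hm0
  have hg' : (0 : ℝ) < g := by exact_mod_cast hg
  have h1 : intVec v = (ℓ / g) • u := by
    have h2 : intVec ((g : ℤ) * v.1, (g : ℤ) * v.2) = (g : ℝ) • intVec v := by
      apply plane_ext <;> simp
    rw [h2] at hm
    rw [div_eq_inv_mul, mul_smul, hm, smul_smul, inv_mul_cancel₀ hg'.ne', one_smul]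
  refine ⟨v, hv, ?_⟩
  have h3 : ‖intVec v‖ = ℓ / g := by
    rw [h1, norm_smul, hu, mul_one, Real.norm_of_nonneg (by positivity)]
  rw [h3]; exact h1

/-- The points whose closed leaf in the direction of `v` avoids `0` and `x`. -/
def regularLeaves (v : ℤ × ℤ) (x : Torus) : Set Torus :=
  {y | transverse v y ≠ 0 ∧ transverse v y ≠ transverse v x}

section Direction

variable {v : ℤ × ℤ} (hv : v ∈ primitiveVectors) {u : EuclideanSpace ℝ (Fin 2)}
  (huv : intVec v = ‖intVec v‖ • u)

lemma norm_intVec_pos {v : ℤ × ℤ} (hv : v ∈ primitiveVectors) : 0 < ‖intVec v‖ :=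
  norm_pos_iff.2 (intVec_ne_zero (primitiveVectors_ne_zero hv))

include hv huv

lemma smul_direction_eq (r : ℝ) : r • u = (r / ‖intVec v‖) • intVec v := by
  have hL := norm_intVec_pos hv
  conv_rhs => rw [huv, smul_smul]
  rw [norm_smul, norm_norm]
  rw [show r / (‖intVec v‖ * ‖u‖) * ‖intVec v‖ = r by
    -- The relation `huv` alone already forces `u` to be a unit vector.
    have h1 : ‖u‖ = 1 := by
      have := congrArg norm huv
      rw [norm_smul, norm_norm] at this
      exact (mul_right_cancel₀ hL.ne' (by linarith : ‖u‖ * ‖intVec v‖ = 1 * ‖intVec v‖))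
    rw [h1, mul_one]
    field_simp]

/-- Time `r` is `r / ‖intVec v‖` times `v`, and a multiple of a primitive vector is integral only
for an integer factor. -/
lemma isLeast_period (y : Torus) :
    IsLeast {r : ℝ | 0 < r ∧ geodesic y u r = y} ‖intVec v‖ := by
  have hL := norm_intVec_pos hv
  constructor
  · refine ⟨hL, geodesic_eq_self_iff.2 ?_⟩
    rw [← huv, torusProj_intVec]
  · rintro r ⟨hr, h⟩
    rw [geodesic_eq_self_iff, smul_direction_eq hv huv,
      torusProj_smul_intVec_eq_zero_iff hv] at h
    obtain ⟨k, hk⟩ := h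
    have hk0 : (0 : ℝ) < k := by rw [← hk]; positivity
    have hk1 : (1 : ℝ) ≤ k := by exact_mod_cast (by exact_mod_cast hk0 : (0 : ℤ) < k)
    rw [← hk, le_div_iff₀ hL, one_mul] at hk1
    exact hk1

lemma geodesic_mem_orbit_iff (y z : Torus) :
    (∃ t : ℝ, geodesic y u t = z) ↔ transverse v y = transverse v z := by
  have hL := norm_intVec_pos hv
  rw [eq_comm, ← sub_eq_zero, ← map_sub, transverse_eq_zero_iff hv]
  constructor
  · rintro ⟨t, rfl⟩
    exact ⟨t / ‖intVec v‖, by rw [← smul_direction_eq hv huv]; simp [geodesic]⟩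
  · rintro ⟨s, hs⟩
    refine ⟨s * ‖intVec v‖, ?_⟩
    rw [geodesic, smul_direction_eq hv huv, mul_div_cancel_right₀ _ hL.ne', ← hs]
    abel

lemma periodicRegularPoints_eq (x : Torus) :
    periodicRegularPoints {0, x} u = regularLeaves v x := by
  ext y
  have h1 : ∃ ℓ : ℝ, 0 < ℓ ∧ geodesic y u ℓ = y := ⟨_, (isLeast_period hv huv y).1⟩
  have h2 := geodesic_mem_orbit_iff hv huv y 0
  have h3 := geodesic_mem_orbit_iff hv huv y x
  rw [map_zero] at h2
  simp only [periodicRegularPoints, regularLeaves, Set.mem_ofPred_eq, h1, true_and,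
    Set.mem_insert_iff, Set.mem_singleton_iff, not_or, forall_and, ← h2, ← h3, not_exists, ne_eq]

end Direction

/-! ### Cylinders as strips, and their number -/

/-- The union of the closed leaves in the direction of `v` whose transverse coordinate lies in the
image of an interval. -/
def strip (v : ℤ × ℤ) (a b : ℝ) : Set Torus :=
  {y | ∃ s ∈ Set.Ioo a b, transverse v y = (s : UnitAddCircle)}

lemma isOpen_strip (v : ℤ × ℤ) (a b : ℝ) : IsOpen (strip v a b) := by
  have h : strip v a b = transverse v ⁻¹' ((fun s : ℝ => (s : UnitAddCircle)) '' Set.Ioo a b) := by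
    ext y
    simp only [strip, Set.mem_ofPred_eq, Set.mem_preimage, Set.mem_image, eq_comm]
  rw [h]
  exact (QuotientAddGroup.isOpenMap_coe _ isOpen_Ioo).preimage (continuous_transverse v)

/-- Bézout supplies a vector `w = (-β, α)` of transverse coordinate `1`; in the linear coordinates
`(t, s) ↦ t v + s w` the strip is the image of a convex set, hence connected. -/
lemma strip_eq_image {v : ℤ × ℤ} (hv : v ∈ primitiveVectors) :
    ∃ w : EuclideanSpace ℝ (Fin 2), ∀ a b, strip v a b =
      (fun z : ℝ × ℝ => torusProj (z.1 • intVec v + z.2 • w)) '' (Set.univ ×ˢ Set.Ioo a b) := by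
  obtain ⟨α, β, hab⟩ := exists_bezout_real hv
  set w : EuclideanSpace ℝ (Fin 2) := !₂[-(β : ℝ), (α : ℝ)] with hw
  have hw0 : w 0 = -β := rfl
  have hw1 : w 1 = α := rfl
  have htw : ∀ s : ℝ, transverse v (torusProj (s • w)) = (s : UnitAddCircle) := by
    intro s
    rw [transverse_torusProj]
    simp only [PiLp.smul_apply, hw0, hw1, smul_eq_mul]
    congr 1
    linear_combination s * hab
  refine ⟨w, fun a b => ?_⟩
  ext y
  simp only [strip, Set.mem_ofPred_eq, Set.mem_image, Set.mem_prod, Set.mem_univ, true_and,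
    Prod.exists]
  constructor
  · rintro ⟨s, hs, h⟩
    rw [← htw s, ← sub_eq_zero, ← map_sub, transverse_eq_zero_iff hv] at h
    obtain ⟨t, ht⟩ := h
    exact ⟨t, s, hs, by rw [torusProj_add, ← ht]; abel⟩
  · rintro ⟨t, s, hs, rfl⟩
    refine ⟨s, hs, ?_⟩
    rw [torusProj_add, map_add, htw, transverse_smul_intVec, zero_add]

lemma isPreconnected_strip {v : ℤ × ℤ} (hv : v ∈ primitiveVectors) (a b : ℝ) :
    IsPreconnected (strip v a b) := by
  obtain ⟨w, hw⟩ := strip_eq_image hv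
  rw [hw]
  refine (isPreconnected_univ.prod isPreconnected_Ioo).image _ (Continuous.continuousOn ?_)
  exact continuous_torusProj.comp (by fun_prop)

lemma strip_nonempty {v : ℤ × ℤ} (hv : v ∈ primitiveVectors) {a b : ℝ} (h : a < b) :
    (strip v a b).Nonempty := by
  obtain ⟨w, hw⟩ := strip_eq_image hv
  rw [hw]
  exact (Set.univ_nonempty.prod (Set.nonempty_Ioo.2 h)).image _

lemma add_mem_strip {v : ℤ × ℤ} {a b : ℝ} {y : Torus} (hy : y ∈ strip v a b) (s : ℝ) :
    y + torusProj (s • intVec v) ∈ strip v a b := by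
  obtain ⟨r, hr, h⟩ := hy
  exact ⟨r, hr, by rw [map_add, transverse_smul_intVec, add_zero, h]⟩

/-- One point may be an endpoint provided the other is interior, since the difference then still
lies in `(-1, 1)`. -/
lemma unitAddCircle_coe_inj {a b : ℝ} (ha : a ∈ Set.Icc (0 : ℝ) 1) (hb : b ∈ Set.Ioo (0 : ℝ) 1)
    (h : (a : UnitAddCircle) = b) : a = b := by
  rw [← sub_eq_zero, ← AddCircle.coe_sub, unitAddCircle_coe_eq_zero_iff] at h
  obtain ⟨k, hk⟩ := h
  have h1 : (k : ℝ) < 1 := by rw [← hk]; linarith [ha.2, hb.1]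
  have h2 : (-1 : ℝ) < k := by rw [← hk]; linarith [ha.1, hb.2]
  have h3 : k < 1 := by exact_mod_cast h1
  have h4 : -1 < k := by exact_mod_cast h2
  have : k = 0 := by omega
  rw [this] at hk
  push_cast at hk
  linarith

lemma disjoint_strip (v : ℤ × ℤ) {θ : ℝ} (hθ : θ ∈ Set.Ico (0 : ℝ) 1) :
    Disjoint (strip v 0 θ) (strip v θ 1) := by
  rw [Set.disjoint_left]
  rintro y ⟨s, hs, h⟩ ⟨t, ht, h'⟩
  have := unitAddCircle_coe_inj ⟨hs.1.le, hs.2.le.trans hθ.2.le⟩ ⟨hθ.1.trans_lt ht.1, ht.2⟩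
    (h.symm.trans h')
  linarith [hs.2, ht.1]

lemma exists_lift_unitAddCircle (z : UnitAddCircle) :
    ∃ θ ∈ Set.Ico (0 : ℝ) 1, z = (θ : UnitAddCircle) := by
  obtain ⟨a, rfl⟩ := QuotientAddGroup.mk_surjective z
  refine ⟨Int.fract a, ⟨Int.fract_nonneg a, Int.fract_lt_one a⟩, ?_⟩
  change (a : UnitAddCircle) = _
  rw [← sub_eq_zero, ← AddCircle.coe_sub, unitAddCircle_coe_eq_zero_iff]
  exact ⟨⌊a⌋, by rw [Int.self_sub_fract]⟩

/-- The transverse coordinate of `x` in the direction of `v`, as a number in `[0, 1)`. -/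
noncomputable def transverseLift (v : ℤ × ℤ) (x : Torus) : ℝ :=
  (exists_lift_unitAddCircle (transverse v x)).choose

lemma transverseLift_mem (v : ℤ × ℤ) (x : Torus) : transverseLift v x ∈ Set.Ico (0 : ℝ) 1 :=
  (exists_lift_unitAddCircle (transverse v x)).choose_spec.1

lemma coe_transverseLift (v : ℤ × ℤ) (x : Torus) :
    transverse v x = (transverseLift v x : UnitAddCircle) :=
  (exists_lift_unitAddCircle (transverse v x)).choose_spec.2

lemma transverseLift_eq_zero_iff {v : ℤ × ℤ} {x : Torus} :
    transverseLift v x = 0 ↔ transverse v x = 0 := by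
  have hm := transverseLift_mem v x
  have h := coe_transverseLift v x
  constructor
  · intro h0
    rw [h, h0]; simp
  · intro h0
    by_contra hne
    have := unitAddCircle_coe_inj (a := 0) (by simp)
      ⟨lt_of_le_of_ne hm.1 (Ne.symm hne), hm.2⟩ (by rw [← h, h0]; simp)
    exact hne this.symm

/-- The circle minus the points `0` and `θ` is the union of the arcs `(0, θ)` and `(θ, 1)`. In the
aligned case `θ = 0` and the first arc is empty. -/
lemma regularLeaves_eq (v : ℤ × ℤ) (x : Torus) :
    regularLeaves v x = strip v 0 (transverseLift v x) ∪ strip v (transverseLift v x) 1 := by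
  have hm := transverseLift_mem v x
  have h := coe_transverseLift v x
  ext y
  simp only [regularLeaves, strip, Set.mem_union, Set.mem_ofPred_eq]
  constructor
  · rintro ⟨h0, h1⟩
    obtain ⟨s, hs, hys⟩ := exists_lift_unitAddCircle (transverse v y)
    have hs0 : s ≠ 0 := by rintro rfl; exact h0 (by rw [hys]; simp)
    have hs1 : s ≠ transverseLift v x := by rintro rfl; exact h1 (hys.trans h.symm)
    rcases lt_or_gt_of_ne hs1 with hlt | hlt
    · exact Or.inl ⟨s, ⟨lt_of_le_of_ne hs.1 hs0.symm, hlt⟩, hys⟩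
    · exact Or.inr ⟨s, ⟨hlt, hs.2⟩, hys⟩
  · have aux : ∀ s ∈ Set.Ioo (0 : ℝ) 1, s ≠ transverseLift v x →
        transverse v y = (s : UnitAddCircle) →
        transverse v y ≠ 0 ∧ transverse v y ≠ transverse v x := by
      intro s hs hne hy
      rw [hy, h]
      constructor
      · intro h0
        exact hs.1.ne (unitAddCircle_coe_inj (a := 0) (by simp) hs (by rw [h0]; simp))
      · intro h0
        exact hne (unitAddCircle_coe_inj ⟨hm.1, hm.2.le⟩ hs h0.symm).symm
    rintro (⟨s, hs, hy⟩ | ⟨s, hs, hy⟩)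
    · exact aux s ⟨hs.1, hs.2.trans hm.2⟩ hs.2.ne hy
    · exact aux s ⟨hm.1.trans_lt hs.1, hs.2⟩ hs.1.ne' hy

lemma connectedComponentIn_union_eq {α : Type*} [TopologicalSpace α] {A B : Set α}
    (hA : IsOpen A) (hB : IsOpen B) (hAB : Disjoint A B) (hc : IsPreconnected A) {y : α}
    (hy : y ∈ A) : connectedComponentIn (A ∪ B) y = A := by
  refine Set.Subset.antisymm ?_ (hc.subset_connectedComponentIn hy Set.subset_union_left)
  exact isPreconnected_connectedComponentIn.subset_left_of_subset_union hA hB hAB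
    (connectedComponentIn_subset _ _)
    ⟨y, mem_connectedComponentIn (Set.mem_union_left _ hy), hy⟩

lemma regularLeaves_neg (v : ℤ × ℤ) (x : Torus) : regularLeaves (-v) x = regularLeaves v x := by
  ext y
  simp [regularLeaves, transverse_neg]

lemma isPeriodicCylinder_of_primitive {v : ℤ × ℤ} (hv : v ∈ primitiveVectors) {x y : Torus}
    (hy : y ∈ regularLeaves v x) :
    IsPeriodicCylinder {0, x} (connectedComponentIn (regularLeaves v x) y) ‖intVec v‖ := by
  have hL := norm_intVec_pos hv
  have huv : intVec v = ‖intVec v‖ • (‖intVec v‖⁻¹ • intVec v) := by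
    rw [smul_smul, mul_inv_cancel₀ hL.ne', one_smul]
  refine ⟨‖intVec v‖⁻¹ • intVec v, ?_, ⟨y, ?_, ?_⟩, fun z _ => isLeast_period hv huv z⟩
  · rw [norm_smul, norm_inv, norm_norm, inv_mul_cancel₀ hL.ne']
  · rwa [periodicRegularPoints_eq hv huv]
  · rw [periodicRegularPoints_eq hv huv]

lemma exists_primitive_of_isPeriodicCylinder {x : Torus} {C : Set Torus} {ℓ : ℝ}
    (h : IsPeriodicCylinder {0, x} C ℓ) :
    ∃ v ∈ primitiveVectors, ‖intVec v‖ = ℓ ∧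
      ∃ y ∈ regularLeaves v x, C = connectedComponentIn (regularLeaves v x) y := by
  obtain ⟨u, hu, ⟨y, hy, hC⟩, hℓ⟩ := h
  obtain ⟨r, hr, hyr⟩ := hy.1
  obtain ⟨v, hv, huv⟩ := exists_primitive_of_periodic hu hr (geodesic_eq_self_iff.1 hyr)
  have hreg := periodicRegularPoints_eq hv huv x
  refine ⟨v, hv, ?_, y, hreg ▸ hy, by rw [hC, hreg]⟩
  exact (isLeast_period hv huv y).unique (hℓ y (hC ▸ mem_connectedComponentIn hy))

lemma intVec_mem_disc_iff {v : ℤ × ℤ} {T : ℝ} (hT : 0 < T) :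
    ‖intVec v‖ < T ↔ v ∈ latticeDisc 0 T := by
  rw [norm_lt_iff_sq hT, mem_latticeDisc_zero]; simp

/-- The primitive vectors in whose direction `x` lies on the leaf of `0`. -/
def alignedVectors (x : Torus) : Set (ℤ × ℤ) := {v | v ∈ primitiveVectors ∧ transverse v x = 0}

/-- The two strips are disjoint, open and connected, hence the components. The strip `(0, θ)` counts
only in non-aligned directions, and one of `±v` suffices as both have the same leaves. -/
lemma periodicCylinders_eq (x : Torus) {T : ℝ} (hT : 0 < T) :
    periodicCylinders x T =
      (fun v => strip v (transverseLift v x) 1) '' (latticeDisc 0 T ∩ positivePrimitiveVectors) ∪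
      (fun v => strip v 0 (transverseLift v x)) ''
        (latticeDisc 0 T ∩ (positivePrimitiveVectors \ alignedVectors x)) := by
  ext C
  constructor
  · rintro ⟨ℓ, hℓ, hC⟩
    obtain ⟨v, hv, rfl, y, hy, hC⟩ := exists_primitive_of_isPeriodicCylinder hC
    obtain ⟨w, hw, hwn, hreg⟩ : ∃ w ∈ positivePrimitiveVectors, ‖intVec w‖ = ‖intVec v‖ ∧
        regularLeaves w x = regularLeaves v x := by
      rcases mem_or_neg_mem_positivePrimitiveVectors hv with h | h
      · exact ⟨v, h, rfl, rfl⟩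
      · exact ⟨-v, h, by rw [intVec_neg, norm_neg], regularLeaves_neg v x⟩
    rw [← hreg] at hy hC
    have hdisc := (intVec_mem_disc_iff hT).1 (hwn.trans_lt hℓ)
    have hdisj := disjoint_strip w (transverseLift_mem w x)
    rw [regularLeaves_eq] at hy hC
    rcases hy with hy | hy
    · rw [connectedComponentIn_union_eq (isOpen_strip ..) (isOpen_strip ..) hdisj
        (isPreconnected_strip hw.1 _ _) hy] at hC
      refine Or.inr ⟨w, ⟨hdisc, hw, fun h => ?_⟩, hC.symm⟩
      obtain ⟨s, hs, _⟩ := hy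
      rw [transverseLift_eq_zero_iff.2 h.2] at hs
      exact absurd hs.1 (not_lt.2 hs.2.le)
    · rw [Set.union_comm, connectedComponentIn_union_eq (isOpen_strip ..) (isOpen_strip ..)
        hdisj.symm (isPreconnected_strip hw.1 _ _) hy] at hC
      exact Or.inl ⟨w, ⟨hdisc, hw⟩, hC.symm⟩
  · rintro (⟨v, ⟨hd, hv⟩, rfl⟩ | ⟨v, ⟨hd, hv, hx⟩, rfl⟩)
    · obtain ⟨y, hy⟩ := strip_nonempty hv.1 (transverseLift_mem v x).2
      refine ⟨_, (intVec_mem_disc_iff hT).2 hd, ?_⟩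
      have h := isPeriodicCylinder_of_primitive hv.1 (x := x) (y := y)
        (by rw [regularLeaves_eq]; exact Or.inr hy)
      rwa [regularLeaves_eq, Set.union_comm, connectedComponentIn_union_eq (isOpen_strip ..)
        (isOpen_strip ..) (disjoint_strip v (transverseLift_mem v x)).symm
        (isPreconnected_strip hv.1 _ _) hy] at h
    · have hpos : 0 < transverseLift v x := by
        refine lt_of_le_of_ne (transverseLift_mem v x).1 fun h => hx ⟨hv.1, ?_⟩
        exact transverseLift_eq_zero_iff.1 h.symm
      obtain ⟨y, hy⟩ := strip_nonempty hv.1 hpos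
      refine ⟨_, (intVec_mem_disc_iff hT).2 hd, ?_⟩
      have h := isPeriodicCylinder_of_primitive hv.1 (x := x) (y := y)
        (by rw [regularLeaves_eq]; exact Or.inl hy)
      rwa [regularLeaves_eq, connectedComponentIn_union_eq (isOpen_strip ..)
        (isOpen_strip ..) (disjoint_strip v (transverseLift_mem v x))
        (isPreconnected_strip hv.1 _ _) hy] at h

lemma zero_notMem_strip {v : ℤ × ℤ} {a b : ℝ} (ha : 0 ≤ a) (hb : b ≤ 1) : (0 : Torus) ∉ strip v a b := by
  rintro ⟨s, hs, h⟩
  have h0 := unitAddCircle_coe_inj (a := 0) (by simp) ⟨ha.trans_lt hs.1, hs.2.trans_le hb⟩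
    (by rw [← h]; simp)
  linarith [hs.1]

/-- A strip is invariant under translation along its direction. If it were a strip for two
independent directions, it would be invariant under all translations and contain `0`, which it does
not. -/
lemma eq_of_strip_eq {v w : ℤ × ℤ} (hv : v ∈ positivePrimitiveVectors)
    (hw : w ∈ positivePrimitiveVectors) {a b a' b' : ℝ} (ha : 0 ≤ a) (hab : a < b) (hb : b ≤ 1)
    (h : strip v a b = strip w a' b') : v = w := by
  refine eq_of_parallel_of_mem_positive hv hw ?_
  by_contra hne
  obtain ⟨y, hy⟩ := strip_nonempty hv.1 hab
  obtain ⟨V, rfl⟩ := torusProj_surjective y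
  set D : ℝ := v.1 * w.2 - v.2 * w.1 with hD
  have hD0 : D ≠ 0 := by
    rw [hD, sub_ne_zero]
    exact_mod_cast hne
  -- The coefficients here and for `h2` solve `V + s v + t w = 0` by Cramer's rule.
  have h1 := add_mem_strip hy (-(V 0 * w.2 - V 1 * w.1) / D)
  rw [h] at h1
  have h2 := add_mem_strip h1 (-(v.1 * V 1 - v.2 * V 0) / D)
  rw [← h] at h2
  refine zero_notMem_strip (v := v) ha hb ?_
  convert h2
  rw [← torusProj_add, ← torusProj_add, ← torusProj_zero]
  congr 1
  apply plane_ext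
  · simp
    field_simp
    rw [hD]; ring
  · simp
    field_simp
    rw [hD]; ring

lemma periodicCylinders_finite (x : Torus) (T : ℝ) : (periodicCylinders x T).Finite := by
  -- The explicit description needs a positive length bound.
  have hsub : periodicCylinders x T ⊆ periodicCylinders x (max T 1) :=
    fun C ⟨ℓ, hℓ, h⟩ => ⟨ℓ, hℓ.trans_le (le_max_left _ _), h⟩
  refine Set.Finite.subset ?_ hsub
  rw [periodicCylinders_eq x (lt_max_of_lt_right one_pos)]
  exact (((latticeDisc_finite _ _).inter_of_left _).image _).union
    (((latticeDisc_finite _ _).inter_of_left _).image _)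

lemma Npo_eq (x : Torus) {T : ℝ} (hT : 0 < T) :
    Npo x T = (latticeDisc 0 T ∩ positivePrimitiveVectors).ncard +
      (latticeDisc 0 T ∩ (positivePrimitiveVectors \ alignedVectors x)).ncard := by
  have hpos : ∀ v ∈ positivePrimitiveVectors \ alignedVectors x, 0 < transverseLift v x := by
    intro v hv
    refine lt_of_le_of_ne (transverseLift_mem v x).1 fun h => hv.2 ⟨hv.1.1, ?_⟩
    exact transverseLift_eq_zero_iff.1 h.symm
  have hθ := fun v => transverseLift_mem v x
  have hfin : ∀ Q : Set (ℤ × ℤ), (latticeDisc 0 T ∩ Q).Finite :=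
    fun Q => (latticeDisc_finite 0 T).inter_of_left Q
  rw [Npo, periodicCylinders_eq x hT, Set.ncard_union_eq _ ((hfin _).image _) ((hfin _).image _),
    Set.InjOn.ncard_image, Set.InjOn.ncard_image]
  · rintro v ⟨_, hv⟩ w ⟨_, hw⟩ h
    exact eq_of_strip_eq hv.1 hw.1 le_rfl (hpos v hv) (hθ v).2.le h
  · rintro v ⟨_, hv⟩ w ⟨_, hw⟩ h
    exact eq_of_strip_eq hv hw (hθ v).1 (hθ v).2 le_rfl h
  · rw [Set.disjoint_left]
    rintro _ ⟨v, ⟨_, hv⟩, rfl⟩ ⟨w, ⟨_, hw⟩, h⟩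
    -- A cylinder in both families would have one direction, and its two disjoint strips would
    -- coincide.
    have hwv := eq_of_strip_eq hw.1 hv le_rfl (hpos w hw) (hθ w).2.le h
    subst hwv
    obtain ⟨y, hy⟩ := strip_nonempty hv.1 (hθ w).2
    have hy' : y ∈ strip w 0 (transverseLift w x) := by
      have h' : strip w 0 (transverseLift w x) = strip w (transverseLift w x) 1 := h
      rw [h']; exact hy
    exact Set.disjoint_left.1 (disjoint_strip w (hθ w)) hy' hy

/-! ### Saddle connections and their number -/

/-- The geodesic segment issuing from `p` with displacement `V`. -/
def torusSegment (p : Torus) (V : EuclideanSpace ℝ (Fin 2)) : Set Torus :=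
  (fun s : ℝ => p + torusProj (s • V)) '' Set.Icc 0 1

lemma mem_saddleConnections_iff {x : Torus} {T : ℝ} {σ : Set Torus} :
    σ ∈ saddleConnections x T ↔ ∃ p ∈ ({0, x} : Set Torus), ∃ V, V ≠ 0 ∧ ‖V‖ < T ∧
      p + torusProj V ∈ ({0, x} : Set Torus) ∧
      (∀ s ∈ Set.Ioo (0 : ℝ) 1, p + torusProj (s • V) ∉ ({0, x} : Set Torus)) ∧
      σ = torusSegment p V := by
  constructor
  · rintro ⟨ℓ, hℓT, hℓ, p, u, hu, hp, hend, hint, rfl⟩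
    refine ⟨p, hp, ℓ • u, ?_, ?_, hend, ?_, ?_⟩
    · rw [← norm_ne_zero_iff, norm_smul, hu, mul_one, norm_ne_zero_iff]
      exact hℓ.ne'
    · rwa [norm_smul, hu, mul_one, Real.norm_of_nonneg hℓ.le]
    · intro s hs
      rw [smul_smul]
      exact hint _ ⟨mul_pos hs.1 hℓ, by nlinarith [hs.2]⟩
    · ext y
      simp only [torusSegment, Set.mem_image, Set.mem_Icc, geodesic, smul_smul]
      constructor
      · rintro ⟨t, ⟨h0, h1⟩, rfl⟩
        exact ⟨t / ℓ, ⟨by positivity, by rwa [div_le_one hℓ]⟩, by rw [div_mul_cancel₀ _ hℓ.ne']⟩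
      · rintro ⟨s, ⟨h0, h1⟩, rfl⟩
        exact ⟨s * ℓ, ⟨by positivity, by nlinarith⟩, rfl⟩
  · rintro ⟨p, hp, V, hV0, hVT, hend, hint, rfl⟩
    have hL : 0 < ‖V‖ := norm_pos_iff.2 hV0
    have hV : ∀ t : ℝ, t • ‖V‖⁻¹ • V = (t / ‖V‖) • V := fun t => by
      rw [smul_smul, div_eq_mul_inv]
    refine ⟨‖V‖, hVT, hL, p, ‖V‖⁻¹ • V, ?_, hp, ?_, ?_, ?_⟩
    · rw [norm_smul, norm_inv, norm_norm, inv_mul_cancel₀ hL.ne']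
    · rw [geodesic, hV, div_self hL.ne', one_smul]; exact hend
    · intro t ht
      rw [geodesic, hV]
      exact hint _ ⟨div_pos ht.1 hL, (div_lt_one hL).2 ht.2⟩
    · ext y
      simp only [torusSegment, Set.mem_image, Set.mem_Icc, geodesic, hV]
      constructor
      · rintro ⟨s, ⟨h0, h1⟩, rfl⟩
        exact ⟨s * ‖V‖, ⟨by positivity, by nlinarith⟩, by rw [mul_div_cancel_right₀ _ hL.ne']⟩
      · rintro ⟨t, ⟨h0, h1⟩, rfl⟩
        exact ⟨t / ‖V‖, ⟨by positivity, by rwa [div_le_one hL]⟩, rfl⟩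

lemma torusProj_smul_intVec_fract (v : ℤ × ℤ) (s : ℝ) :
    torusProj (Int.fract s • intVec v) = torusProj (s • intVec v) := by
  refine torusProj_eq_iff.2 ⟨(-⌊s⌋ * v.1, -⌊s⌋ * v.2), plane_ext ?_ ?_⟩
  · simp [← Int.self_sub_floor]; ring
  · simp [← Int.self_sub_floor]; ring

/-- A closed loop sweeps out a whole leaf, since fractional parts bring every parameter into `[0,
1)`. It therefore depends neither on the sign of `v` nor on the base point in the leaf. -/
lemma torusSegment_intVec {v : ℤ × ℤ} (hv : v ∈ primitiveVectors) (p : Torus) :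
    torusSegment p (intVec v) = {y | transverse v y = transverse v p} := by
  ext y
  simp only [torusSegment, Set.mem_image, Set.mem_ofPred_eq]
  constructor
  · rintro ⟨s, _, rfl⟩
    rw [map_add, transverse_smul_intVec, add_zero]
  · intro h
    rw [← sub_eq_zero, ← map_sub, transverse_eq_zero_iff hv] at h
    obtain ⟨s, hs⟩ := h
    refine ⟨Int.fract s, ⟨Int.fract_nonneg s, (Int.fract_lt_one s).le⟩, ?_⟩
    rw [torusProj_smul_intVec_fract, ← hs]
    abel

lemma torusSegment_intVec_neg {v : ℤ × ℤ} (hv : v ∈ primitiveVectors) (p : Torus) :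
    torusSegment p (intVec (-v)) = torusSegment p (intVec v) := by
  rw [torusSegment_intVec hv, torusSegment_intVec (neg_mem_primitiveVectors hv)]
  simp [transverse_neg]

lemma exists_primitive_of_closed {V : EuclideanSpace ℝ (Fin 2)} (hV : V ≠ 0)
    (h : torusProj V = 0) (hint : ∀ s ∈ Set.Ioo (0 : ℝ) 1, torusProj (s • V) ≠ 0) :
    ∃ v ∈ primitiveVectors, V = intVec v := by
  obtain ⟨m, rfl⟩ := torusProj_eq_zero_iff.1 h
  have hm : m ≠ 0 := by
    rintro rfl
    exact hV (by apply plane_ext <;> simp)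
  obtain ⟨v, hv, g, hg, rfl⟩ := exists_primitive_smul hm
  have hg1 : g = 1 := by
    by_contra hne
    have hg2 : (1 : ℝ) < g := by exact_mod_cast lt_of_le_of_ne hg (Ne.symm hne)
    -- If the content `g` exceeds `1`, the segment already closes up at parameter `1/g`.
    refine hint (g : ℝ)⁻¹ ⟨by positivity, inv_lt_one_of_one_lt₀ hg2⟩
      (torusProj_eq_zero_iff.2 ⟨v, plane_ext ?_ ?_⟩)
    · simp; field_simp
    · simp; field_simp
  exact ⟨v, hv, by simp [hg1]⟩

lemma torusProj_smul_intVec_ne_zero {v : ℤ × ℤ} (hv : v ∈ primitiveVectors) {s : ℝ}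
    (hs : s ∈ Set.Ioo (0 : ℝ) 1) : torusProj (s • intVec v) ≠ 0 := by
  intro h
  obtain ⟨k, rfl⟩ := (torusProj_smul_intVec_eq_zero_iff hv).1 h
  have h1 : 0 < k := by exact_mod_cast hs.1
  have h2 : k < 1 := by exact_mod_cast hs.2
  omega

lemma forall_torusProj_smul_ne_iff {v : ℤ × ℤ} (hv : v ∈ primitiveVectors) {z : Torus}
    (hz : z ≠ 0) : (∀ s ∈ Set.Ioo (0 : ℝ) 1, torusProj (s • intVec v) ≠ z) ↔ transverse v z ≠ 0 := by
  rw [Ne, transverse_eq_zero_iff hv, not_exists]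
  constructor
  · intro h s hs
    refine h (Int.fract s) ⟨lt_of_le_of_ne (Int.fract_nonneg s) fun h0 => hz ?_,
      Int.fract_lt_one s⟩ ?_
    · rw [hs, ← torusProj_smul_intVec_fract, ← h0, zero_smul, torusProj_zero]
    · rw [torusProj_smul_intVec_fract, hs]
  · intro h s _ hs
    exact h s hs.symm

/-- The lattice vectors `m` for which the segment from the origin to `X + m` meets the marked
points of the torus only at its ends. -/
def visibleShifts (X : EuclideanSpace ℝ (Fin 2)) : Set (ℤ × ℤ) :=
  {m | ∀ s ∈ Set.Ioo (0 : ℝ) 1, torusProj (s • (X + intVec m)) ≠ 0 ∧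
    torusProj (s • (X + intVec m)) ≠ torusProj X}

lemma mem_shiftedDisc_iff {X : EuclideanSpace ℝ (Fin 2)} {m : ℤ × ℤ} {T : ℝ} (hT : 0 < T) :
    m ∈ latticeDisc (X 0, X 1) T ↔ ‖X + intVec m‖ < T := by
  rw [norm_lt_iff_sq hT]
  simp [latticeDisc, add_comm]

/-- The families are the loops at `0`, the loops at `x` and the arcs from `0` to `x`; an arc from
`x` to `0` is one of the last kind reversed. Loops require a non-aligned direction, as otherwise the
other marked point is in their interior. -/
lemma saddleConnections_eq {X : EuclideanSpace ℝ (Fin 2)} (hX : torusProj X ≠ 0) {T : ℝ}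
    (hT : 0 < T) :
    saddleConnections (torusProj X) T =
      (fun v => torusSegment 0 (intVec v)) ''
        (latticeDisc 0 T ∩ (positivePrimitiveVectors \ alignedVectors (torusProj X))) ∪
      (fun v => torusSegment (torusProj X) (intVec v)) ''
        (latticeDisc 0 T ∩ (positivePrimitiveVectors \ alignedVectors (torusProj X))) ∪
      (fun m => torusSegment 0 (X + intVec m)) ''
        (latticeDisc (X 0, X 1) T ∩ visibleShifts X) := by
  set x := torusProj X with hx
  ext σ
  rw [mem_saddleConnections_iff]
  constructor
  · rintro ⟨p, hp, V, hV0, hVT, hend, hint, rfl⟩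
    simp only [Set.mem_insert_iff, Set.mem_singleton_iff, not_or] at hp hend hint
    -- This treats loops at both base points; its first premise says that a loop in an aligned
    -- direction runs into a marked point.
    have loop : ∀ p, (∀ v ∈ primitiveVectors, transverse v x = 0 →
        ∃ s ∈ Set.Ioo (0 : ℝ) 1, p + torusProj (s • intVec v) = 0 ∨
          p + torusProj (s • intVec v) = x) → torusProj V = 0 →
        (∀ s ∈ Set.Ioo (0 : ℝ) 1, torusProj (s • V) ≠ 0) →
        (∀ s ∈ Set.Ioo (0 : ℝ) 1, ¬ (p + torusProj (s • V) = 0) ∧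
          ¬ (p + torusProj (s • V) = x)) →
        torusSegment p V ∈ (fun v => torusSegment p (intVec v)) ''
        (latticeDisc 0 T ∩ (positivePrimitiveVectors \ alignedVectors x)) := by
      intro p hp hV hne hint
      obtain ⟨v, hv, rfl⟩ := exists_primitive_of_closed hV0 hV hne
      have hal : transverse v x ≠ 0 := by
        intro h
        obtain ⟨s, hs, h⟩ := hp v hv h
        have := hint s hs
        tauto
      rcases mem_or_neg_mem_positivePrimitiveVectors hv with h | h
      · exact ⟨v, ⟨(intVec_mem_disc_iff hT).1 hVT, h, fun h' => hal h'.2⟩, rfl⟩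
      · refine ⟨-v, ⟨(intVec_mem_disc_iff hT).1 ?_, h, fun h' => hal ?_⟩,
          torusSegment_intVec_neg hv p⟩
        · rwa [intVec_neg, norm_neg]
        · have := h'.2
          rwa [transverse_neg, neg_eq_zero] at this
    have visible : ∀ W, torusProj W = x → ‖W‖ < T →
        (∀ s ∈ Set.Ioo (0 : ℝ) 1, torusProj (s • W) ≠ 0 ∧ torusProj (s • W) ≠ x) →
        torusSegment 0 W ∈ (fun m => torusSegment 0 (X + intVec m)) ''
          (latticeDisc (X 0, X 1) T ∩ visibleShifts X) := by
      intro W hW hWT hvis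
      obtain ⟨m, rfl⟩ := torusProj_eq_iff.1 (hW.trans hx)
      exact ⟨m, ⟨(mem_shiftedDisc_iff hT).2 hWT, hvis⟩, rfl⟩
    rcases hp with rfl | rfl
    · simp only [zero_add] at hend hint
      rcases hend with h | h
      · refine Or.inl (Or.inl (loop 0 ?_ h (fun s hs => (hint s hs).1) (by simpa using hint)))
        intro v hv hal
        have := mt (forall_torusProj_smul_ne_iff hv hX).1 (not_not.2 hal)
        push Not at this
        obtain ⟨s, hs, h⟩ := this
        exact ⟨s, hs, Or.inr (by rw [zero_add, h])⟩
      · exact Or.inr (visible V h hVT hint)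
    · rcases hend with h | h
      · have hneg : x = torusProj (-V) := by rw [torusProj_neg]; exact eq_neg_of_add_eq_zero_left h
        have hrev : ∀ s : ℝ, torusProj (s • -V) = x + torusProj ((1 - s) • V) := by
          intro s
          rw [hneg, ← torusProj_add]
          congr 1
          module
        have hseg : torusSegment x V = torusSegment 0 (-V) := by
          ext y
          simp only [torusSegment, Set.mem_image, Set.mem_Icc, zero_add, hrev]
          constructor
          · rintro ⟨s, ⟨h0, h1⟩, rfl⟩
            exact ⟨1 - s, ⟨by linarith, by linarith⟩, by rw [sub_sub_cancel]⟩
          · rintro ⟨s, ⟨h0, h1⟩, rfl⟩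
            exact ⟨1 - s, ⟨by linarith, by linarith⟩, rfl⟩
        rw [hseg]
        refine Or.inr (visible (-V) hneg.symm (by rwa [norm_neg]) fun s hs => ?_)
        rw [hrev]
        exact hint (1 - s) ⟨by linarith [hs.2], by linarith [hs.1]⟩
      · refine Or.inl (Or.inr (loop x ?_ (by simpa using h) (fun s hs h0 => ?_) hint))
        · intro v hv hal
          have := mt (forall_torusProj_smul_ne_iff hv (neg_ne_zero.2 hX)).1
            (not_not.2 (by rw [map_neg, hal, neg_zero]))
          push Not at this
          obtain ⟨s, hs, h⟩ := this
          exact ⟨s, hs, Or.inl (by rw [h, add_neg_cancel])⟩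
        · exact (hint s hs).2 (by rw [h0, add_zero])
  · simp only [Set.mem_insert_iff, Set.mem_singleton_iff, not_or]
    rintro ((⟨v, ⟨hd, hv, hal⟩, rfl⟩ | ⟨v, ⟨hd, hv, hal⟩, rfl⟩) | ⟨m, ⟨hd, hm⟩, rfl⟩)
    · have hal' : transverse v x ≠ 0 := fun h => hal ⟨hv.1, h⟩
      refine ⟨0, Or.inl rfl, intVec v, intVec_ne_zero (primitiveVectors_ne_zero hv.1),
        (intVec_mem_disc_iff hT).2 hd, Or.inl (by simp), fun s hs => ?_, rfl⟩
      rw [zero_add]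
      exact ⟨torusProj_smul_intVec_ne_zero hv.1 hs,
        (forall_torusProj_smul_ne_iff hv.1 hX).2 hal' s hs⟩
    · have hal' : transverse v (-x) ≠ 0 := fun h => hal ⟨hv.1, by rwa [map_neg, neg_eq_zero] at h⟩
      refine ⟨x, Or.inr rfl, intVec v, intVec_ne_zero (primitiveVectors_ne_zero hv.1),
        (intVec_mem_disc_iff hT).2 hd, Or.inr (by simp), fun s hs => ?_, rfl⟩
      refine ⟨fun h => (forall_torusProj_smul_ne_iff hv.1 (neg_ne_zero.2 hX)).2 hal' s hs
        (eq_neg_of_add_eq_zero_right h), fun h => torusProj_smul_intVec_ne_zero hv.1 hs ?_⟩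
      simpa using h
    · have hend : torusProj (X + intVec m) = x := by rw [torusProj_add, torusProj_intVec, add_zero]
      refine ⟨0, Or.inl rfl, X + intVec m, ?_, (mem_shiftedDisc_iff hT).1 hd,
        Or.inr (by rw [zero_add, hend]), fun s hs => ?_, rfl⟩
      · intro h
        rw [h, torusProj_zero] at hend
        exact hX hend.symm
      · rw [zero_add]; exact hm s hs

lemma saddleConnections_zero_eq {T : ℝ} (hT : 0 < T) :
    saddleConnections 0 T =
      (fun v => torusSegment 0 (intVec v)) '' (latticeDisc 0 T ∩ positivePrimitiveVectors) := by
  ext σ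
  rw [mem_saddleConnections_iff]
  simp only [Set.mem_insert_iff, Set.mem_singleton_iff, or_self, exists_eq_left, zero_add]
  constructor
  · rintro ⟨V, hV0, hVT, hend, hint, rfl⟩
    obtain ⟨v, hv, rfl⟩ := exists_primitive_of_closed hV0 hend hint
    rcases mem_or_neg_mem_positivePrimitiveVectors hv with h | h
    · exact ⟨v, ⟨(intVec_mem_disc_iff hT).1 hVT, h⟩, rfl⟩
    · refine ⟨-v, ⟨(intVec_mem_disc_iff hT).1 ?_, h⟩, torusSegment_intVec_neg hv 0⟩
      rwa [intVec_neg, norm_neg]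
  · rintro ⟨v, ⟨hd, hv⟩, rfl⟩
    exact ⟨intVec v, intVec_ne_zero (primitiveVectors_ne_zero hv.1),
      (intVec_mem_disc_iff hT).2 hd, by simp,
      fun s hs => torusProj_smul_intVec_ne_zero hv.1 hs, rfl⟩

/-- If `V` and `W` were independent, each `s V` would lie on the line of `W` up to a lattice vector
`m`, and pairing with `W` shows that `m` determines `s`. That would inject an interval into a
countable set. -/
lemma parallel_of_torusSegment_subset {p : Torus} {V W : EuclideanSpace ℝ (Fin 2)}
    (h : torusSegment p V ⊆ torusSegment p W) : V 0 * W 1 - V 1 * W 0 = 0 := by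
  by_contra hdet
  have key : ∀ s : Set.Icc (0 : ℝ) 1, ∃ m : ℤ × ℤ, ∃ t : ℝ, (s : ℝ) • V = t • W + intVec m := by
    rintro ⟨s, hs⟩
    obtain ⟨t, _, ht⟩ := h ⟨s, hs, rfl⟩
    obtain ⟨m, hm⟩ := torusProj_eq_iff.1 (add_left_cancel ht.symm)
    exact ⟨m, t, hm⟩
  choose m t hmt using key
  have hinj : Function.Injective m := by
    intro s s' hss
    have h1 := hmt s
    rw [hss] at h1
    have h2 := hmt s'
    have e10 := congrArg (fun v : EuclideanSpace ℝ (Fin 2) => v 0) h1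
    have e11 := congrArg (fun v : EuclideanSpace ℝ (Fin 2) => v 1) h1
    have e20 := congrArg (fun v : EuclideanSpace ℝ (Fin 2) => v 0) h2
    have e21 := congrArg (fun v : EuclideanSpace ℝ (Fin 2) => v 1) h2
    simp only [PiLp.smul_apply, PiLp.add_apply, smul_eq_mul] at e10 e11 e20 e21
    have : ((s : ℝ) - s') * (V 0 * W 1 - V 1 * W 0) = 0 := by
      linear_combination (W 1) * (e10 - e20) - (W 0) * (e11 - e21)
    rcases mul_eq_zero.1 this with h | h
    · exact Subtype.ext (sub_eq_zero.1 h)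
    · exact absurd h hdet
  have hc : (Set.Icc (0 : ℝ) 1).Countable := Set.countable_coe_iff.1 hinj.countable
  have := hc.measure_zero MeasureTheory.volume
  simp at this

lemma eq_of_torusSegment_intVec_eq {v w : ℤ × ℤ} (hv : v ∈ positivePrimitiveVectors)
    (hw : w ∈ positivePrimitiveVectors) {p : Torus}
    (h : torusSegment p (intVec v) = torusSegment p (intVec w)) : v = w := by
  refine eq_of_parallel_of_mem_positive hv hw ?_
  have := parallel_of_torusSegment_subset h.subset
  rw [sub_eq_zero] at this
  simp only [intVec_apply_zero, intVec_apply_one] at this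
  exact_mod_cast this

/-- The segments are parallel, `W = c V`. If `c > 0` and `c ≠ 1`, the shorter one ends at `x` inside
the longer one. If `c < 0` they leave `0` in opposite directions, and the part of `W` near `0` must
be covered by the segment of `V`; this forces `V` itself to close up at `0`. -/
lemma eq_of_torusSegment_visible_eq {x : Torus} (hx : x ≠ 0) {V W : EuclideanSpace ℝ (Fin 2)}
    (hV : torusProj V = x) (hW : torusProj W = x)
    (hVi : ∀ s ∈ Set.Ioo (0 : ℝ) 1, torusProj (s • V) ≠ 0 ∧ torusProj (s • V) ≠ x)
    (hWi : ∀ s ∈ Set.Ioo (0 : ℝ) 1, torusProj (s • W) ≠ 0 ∧ torusProj (s • W) ≠ x)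
    (h : torusSegment 0 V = torusSegment 0 W) : V = W := by
  have hV0 : V ≠ 0 := by rintro rfl; exact hx (by rw [← hV, torusProj_zero])
  have hdet := parallel_of_torusSegment_subset h.subset
  obtain ⟨c, rfl⟩ : ∃ c : ℝ, W = c • V := by
    by_cases h0 : V 0 = 0
    · have h1 : V 1 ≠ 0 := fun h1 => hV0 (plane_ext h0 h1)
      refine ⟨W 1 / V 1, plane_ext ?_ ?_⟩
      · rw [h0, zero_mul, zero_sub, neg_eq_zero, mul_eq_zero] at hdet
        simp [h0, hdet.resolve_left h1]
      · simp [h1]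
    · refine ⟨W 0 / V 0, plane_ext ?_ ?_⟩
      · simp [h0]
      · simp
        field_simp
        linarith
  rcases lt_trichotomy c 0 with hc | hc | hc
  · exfalso
    -- The point of `W` at parameter `ε` equals some `s V` on the torus, so `τ = s - c ε` is a
    -- return time of `V` to `0`. Visibility excludes `τ < 1`, so `τ` tends to `1` with `ε = 1/(k+1)
    -- → 0`.
    have key : ∀ k : ℕ, ∃ τ : ℝ, 1 ≤ τ ∧ τ ≤ 1 + (-c) * (1 / ((k : ℝ) + 1)) ∧
        torusProj (τ • V) = 0 := by
      intro k
      set ε : ℝ := 1 / ((k : ℝ) + 1) with hε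
      have hε0 : 0 < ε := by positivity
      have hε1 : ε ≤ 1 := by
        rw [hε, div_le_one (by positivity)]
        linarith [(Nat.cast_nonneg k : (0 : ℝ) ≤ k)]
      have hmem : (0 : Torus) + torusProj (ε • c • V) ∈ torusSegment 0 V := by
        rw [h]; exact ⟨ε, ⟨hε0.le, hε1⟩, rfl⟩
      obtain ⟨s, ⟨hs0, hs1⟩, hs⟩ := hmem
      have hz : torusProj ((s + (-c) * ε) • V) = 0 := by
        have h1 := add_left_cancel hs
        rw [← sub_eq_zero, ← torusProj_sub] at h1
        rw [← h1]
        congr 1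
        module
      have hpos : 0 < (-c) * ε := mul_pos (neg_pos.2 hc) hε0
      refine ⟨s + (-c) * ε, ?_, by linarith, hz⟩
      by_contra! hlt
      exact (hVi _ ⟨by linarith, hlt⟩).1 hz
    choose τ h1 h2 h3 using key
    have hlim : Tendsto τ atTop (𝓝 1) := by
      refine tendsto_of_tendsto_of_tendsto_of_le_of_le tendsto_const_nhds ?_ h1 h2
      have := (tendsto_one_div_add_atTop_nhds_zero_nat (𝕜 := ℝ)).const_mul (-c)
      simpa using this.const_add 1
    have hcont : Continuous fun t : ℝ => torusProj (t • V) :=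
      continuous_torusProj.comp (by fun_prop)
    have hl := (hcont.tendsto 1).comp hlim
    have h4 : (fun t : ℝ => torusProj (t • V)) ∘ τ = fun _ => 0 := funext h3
    rw [h4, one_smul, hV] at hl
    exact hx (tendsto_nhds_unique hl tendsto_const_nhds)
  · rw [hc, zero_smul, torusProj_zero] at hW
    exact absurd hW.symm hx
  · rcases lt_trichotomy c 1 with hc1 | hc1 | hc1
    · exact absurd hW (hVi c ⟨hc, hc1⟩).2
    · rw [hc1, one_smul]
    · refine absurd ?_ (hWi c⁻¹ ⟨by positivity, inv_lt_one_of_one_lt₀ hc1⟩).2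
      rw [smul_smul, inv_mul_cancel₀ hc.ne', one_smul, hV]

lemma saddleConnections_finite (x : Torus) (T : ℝ) : (saddleConnections x T).Finite := by
  have hsub : saddleConnections x T ⊆ saddleConnections x (max T 1) :=
    fun C ⟨ℓ, hℓ, h⟩ => ⟨ℓ, hℓ.trans_le (le_max_left _ _), h⟩
  refine Set.Finite.subset ?_ hsub
  have hT : 0 < max T 1 := lt_max_of_lt_right one_pos
  obtain ⟨X, rfl⟩ := torusProj_surjective x
  by_cases hX : torusProj X = 0
  · rw [hX, saddleConnections_zero_eq hT]
    exact ((latticeDisc_finite _ _).inter_of_left _).image _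
  · rw [saddleConnections_eq hX hT]
    exact ((((latticeDisc_finite _ _).inter_of_left _).image _).union
      (((latticeDisc_finite _ _).inter_of_left _).image _)).union
      (((latticeDisc_finite _ _).inter_of_left _).image _)

lemma Nsc_zero_eq {T : ℝ} (hT : 0 < T) :
    Nsc 0 T = (latticeDisc 0 T ∩ positivePrimitiveVectors).ncard := by
  rw [Nsc, saddleConnections_zero_eq hT, Set.InjOn.ncard_image]
  rintro v ⟨_, hv⟩ w ⟨_, hw⟩ h
  exact eq_of_torusSegment_intVec_eq hv hw h

/-- The three families are told apart by the marked points they contain: loops at `0` miss `x`,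
loops at `x` miss `0`, and arcs contain both. -/
lemma Nsc_eq {X : EuclideanSpace ℝ (Fin 2)} (hX : torusProj X ≠ 0) {T : ℝ} (hT : 0 < T) :
    Nsc (torusProj X) T =
      2 * (latticeDisc 0 T ∩ (positivePrimitiveVectors \ alignedVectors (torusProj X))).ncard +
        (latticeDisc (X 0, X 1) T ∩ visibleShifts X).ncard := by
  have hfin : ∀ y, ∀ Q : Set (ℤ × ℤ), (latticeDisc y T ∩ Q).Finite :=
    fun y Q => (latticeDisc_finite y T).inter_of_left Q
  have hproj : ∀ m, torusProj (X + intVec m) = torusProj X := fun m => by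
    rw [torusProj_add, torusProj_intVec, add_zero]
  have hzero : ∀ (p : Torus) V, p ∈ torusSegment p V := fun p V =>
    ⟨0, by simp, by simp⟩
  have hone : ∀ m, torusProj X ∈ torusSegment 0 (X + intVec m) := fun m =>
    ⟨1, by simp, by simp [hproj]⟩
  have hA : ∀ v ∈ positivePrimitiveVectors \ alignedVectors (torusProj X),
      torusProj X ∉ torusSegment 0 (intVec v) := by
    intro v hv h
    rw [torusSegment_intVec hv.1.1, Set.mem_ofPred_eq, map_zero] at h
    exact hv.2 ⟨hv.1.1, h⟩
  have hB : ∀ v ∈ positivePrimitiveVectors \ alignedVectors (torusProj X),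
      0 ∉ torusSegment (torusProj X) (intVec v) := by
    intro v hv h
    rw [torusSegment_intVec hv.1.1, Set.mem_ofPred_eq, map_zero] at h
    exact hv.2 ⟨hv.1.1, h.symm⟩
  rw [Nsc, saddleConnections_eq hX hT,
    Set.ncard_union_eq _ (((hfin _ _).image _).union ((hfin _ _).image _)) ((hfin _ _).image _),
    Set.ncard_union_eq _ ((hfin _ _).image _) ((hfin _ _).image _),
    Set.InjOn.ncard_image, Set.InjOn.ncard_image, Set.InjOn.ncard_image, two_mul]
  · rintro m ⟨_, hm⟩ m' ⟨_, hm'⟩ h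
    exact intVec_injective (add_left_cancel
      (eq_of_torusSegment_visible_eq hX (hproj m) (hproj m') hm hm' h))
  · rintro v ⟨_, hv⟩ w ⟨_, hw⟩ h
    exact eq_of_torusSegment_intVec_eq hv.1 hw.1 h
  · rintro v ⟨_, hv⟩ w ⟨_, hw⟩ h
    exact eq_of_torusSegment_intVec_eq hv.1 hw.1 h
  · rw [Set.disjoint_left]
    rintro _ ⟨v, ⟨_, hv⟩, rfl⟩ ⟨w, ⟨_, hw⟩, h⟩
    have h' : torusSegment (torusProj X) (intVec w) = torusSegment 0 (intVec v) := h
    exact hA v hv (h' ▸ hzero _ _)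
  · rw [Set.disjoint_left]
    rintro _ (⟨v, ⟨_, hv⟩, rfl⟩ | ⟨v, ⟨_, hv⟩, rfl⟩) ⟨m, _, h⟩
    · have h' : torusSegment 0 (X + intVec m) = torusSegment 0 (intVec v) := h
      exact hA v hv (h' ▸ hone m)
    · have h' : torusSegment 0 (X + intVec m) = torusSegment (torusProj X) (intVec v) := h
      exact hB v hv (h' ▸ hzero _ _)

/-! ### The growth rates as functions of `n` -/

/-- The product of `1 - 1 / p ^ 2` over the primes dividing `n`. -/
noncomputable def primeProduct (n : ℕ) : ℝ := ∏ p ∈ n.primeFactors, (1 - 1 / (p : ℝ) ^ 2)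

/-- The sum of `1 / i ^ 2` over the integers `1 ≤ i < n` coprime to `n`. -/
noncomputable def coprimeSum (n : ℕ) : ℝ :=
  ∑ i ∈ (Finset.Ico 1 n).filter (fun i => Nat.gcd i n = 1), 1 / (i : ℝ) ^ 2

lemma one_sub_one_div_prime_sq_pos {n p : ℕ} (hp : p ∈ n.primeFactors) :
    0 < 1 - 1 / (p : ℝ) ^ 2 := by
  have h2 : (2 : ℝ) ≤ p := by exact_mod_cast (Nat.prime_of_mem_primeFactors hp).two_le
  rw [sub_pos, div_lt_one (by positivity)]
  nlinarith

lemma primeProduct_pos (n : ℕ) : 0 < primeProduct n :=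
  Finset.prod_pos fun _ hp => one_sub_one_div_prime_sq_pos hp

/-- The added index `0` contributes nothing, even when `n = 1`, because `1 / 0 ^ 2 = 0`. -/
lemma coprimeSum_eq (n : ℕ) : coprimeSum n =
    ∑ i ∈ Finset.range n, if i.Coprime n then 1 / (i : ℝ) ^ 2 else 0 := by
  rw [coprimeSum, ← Finset.sum_filter]
  refine Finset.sum_subset_zero_on_sdiff ?_ ?_ fun _ _ => rfl
  · intro i hi
    simp only [Finset.mem_filter, Finset.mem_Ico, Finset.mem_range] at hi ⊢
    exact ⟨hi.1.2, hi.2⟩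
  · intro i hi
    simp only [Finset.mem_sdiff, Finset.mem_filter, Finset.mem_Ico, Finset.mem_range] at hi
    have : i = 0 := by
      by_contra h
      exact hi.2 ⟨⟨Nat.pos_of_ne_zero h, hi.1.1⟩, hi.1.2⟩
    simp [this]

lemma coprimeSum_le (n : ℕ) [NeZero n] : coprimeSum n ≤ Real.pi ^ 2 / 6 * primeProduct n := by
  rw [coprimeSum_eq]
  refine sum_le_hasSum _ (fun i _ => ?_) (hasSum_coprime_one_div_sq n)
  split_ifs <;> positivity

/-- The tail of the series over integers coprime to `n` is at most the full tail of `ζ(2)`, a bound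
blind to the factorization of `n`. -/
lemma sub_coprimeSum_le (n : ℕ) [NeZero n] :
    Real.pi ^ 2 / 6 * primeProduct n - coprimeSum n ≤
      Real.pi ^ 2 / 6 - ∑ i ∈ Finset.range n, 1 / (i : ℝ) ^ 2 := by
  have h := sum_le_hasSum (Finset.range n) (fun i _ => ?_)
    (hasSum_zeta_two.sub (hasSum_coprime_one_div_sq n))
  · rw [Finset.sum_sub_distrib, ← coprimeSum_eq] at h
    rw [primeProduct]
    linarith
  · split_ifs
    · simp
    · simp

/-- The term `i = 1` of `hasSum_coprime_one_div_sq` is at most the whole sum. -/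
lemma inv_primeProduct_le (n : ℕ) [NeZero n] : (primeProduct n)⁻¹ ≤ Real.pi ^ 2 / 6 := by
  have h := le_hasSum (hasSum_coprime_one_div_sq n) 1 (fun i _ => by split_ifs <;> positivity)
  rw [if_pos (Nat.coprime_one_left n)] at h
  rw [inv_le_iff_one_le_mul₀ (primeProduct_pos n)]
  simpa [primeProduct] using h

/-- The quadratic growth rate of saddle connections at a primitive `n`-torsion point. -/
noncomputable def saddleRate (n : ℕ) : ℝ :=
  6 / Real.pi * (1 + (primeProduct n)⁻¹ * (coprimeSum n - (Nat.totient n : ℝ) / (n : ℝ) ^ 2))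

/-- The quadratic growth rate of cylinders at a primitive `n`-torsion point. -/
noncomputable def cylinderRate (n : ℕ) : ℝ :=
  6 / Real.pi * (1 - (Nat.totient n : ℝ) / (2 * (n : ℝ) ^ 2) * (primeProduct n)⁻¹)

lemma totient_div_sq_pos (n : ℕ) [NeZero n] : 0 < (Nat.totient n : ℝ) / (n : ℝ) ^ 2 := by
  have hn : 0 < n := Nat.pos_of_ne_zero (NeZero.ne n)
  have := Nat.totient_pos.2 hn
  positivity

lemma totient_div_sq_le (n : ℕ) [NeZero n] : (Nat.totient n : ℝ) / (n : ℝ) ^ 2 ≤ 1 / n := by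
  have hn : (0 : ℝ) < n := by exact_mod_cast Nat.pos_of_ne_zero (NeZero.ne n)
  have h : (Nat.totient n : ℝ) ≤ n := by exact_mod_cast Nat.totient_le n
  rw [div_le_div_iff₀ (by positivity) hn]
  nlinarith

/-- Writes the rate as the maximal value minus a deficit: a non-negative series tail plus a totient
term that is positive for `n > 0`. -/
lemma saddleRate_eq (n : ℕ) : saddleRate n = 6 / Real.pi + Real.pi - 6 / Real.pi *
    ((primeProduct n)⁻¹ * (Real.pi ^ 2 / 6 * primeProduct n - coprimeSum n +
      (Nat.totient n : ℝ) / (n : ℝ) ^ 2)) := by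
  have h1 := (primeProduct_pos n).ne'
  have h2 := Real.pi_ne_zero
  rw [saddleRate]
  field_simp
  ring

lemma saddleRate_lt (n : ℕ) [NeZero n] : saddleRate n < 6 / Real.pi + Real.pi := by
  rw [saddleRate_eq, sub_lt_self_iff]
  have h1 := primeProduct_pos n
  have h2 := Real.pi_pos
  have h3 := totient_div_sq_pos n
  have h4 := coprimeSum_le n
  have : 0 < Real.pi ^ 2 / 6 * primeProduct n - coprimeSum n +
      (Nat.totient n : ℝ) / (n : ℝ) ^ 2 := by linarith
  positivity

lemma cylinderRate_lt (n : ℕ) [NeZero n] : cylinderRate n < 6 / Real.pi := by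
  have h1 := primeProduct_pos n
  have h2 := Real.pi_pos
  have h3 := totient_div_sq_pos n
  have h4 : (Nat.totient n : ℝ) / (2 * (n : ℝ) ^ 2) = (Nat.totient n : ℝ) / (n : ℝ) ^ 2 / 2 := by
    rw [div_div, mul_comm]
  rw [cylinderRate, h4]
  refine mul_lt_of_lt_one_right (by positivity) (sub_lt_self _ (by positivity))

/-- The deficit is squeezed by a constant times the tail of `ζ(2)` beyond `n` plus `1/n`. -/
lemma tendsto_saddleRate : Tendsto saddleRate atTop (𝓝 (6 / Real.pi + Real.pi)) := by
  have hpi := Real.pi_pos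
  have h0 : Tendsto (fun n : ℕ => 6 / Real.pi * (Real.pi ^ 2 / 6 *
      ((Real.pi ^ 2 / 6 - ∑ i ∈ Finset.range n, 1 / (i : ℝ) ^ 2) + 1 / (n : ℝ)))) atTop (𝓝 0) := by
    have h1 := (hasSum_zeta_two.tendsto_sum_nat.const_sub (Real.pi ^ 2 / 6)).add
      tendsto_one_div_atTop_nhds_zero_nat
    simpa using (h1.const_mul (Real.pi ^ 2 / 6)).const_mul (6 / Real.pi)
  have h1 : Tendsto (fun n : ℕ => 6 / Real.pi *
      ((primeProduct n)⁻¹ * (Real.pi ^ 2 / 6 * primeProduct n - coprimeSum n +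
      (Nat.totient n : ℝ) / (n : ℝ) ^ 2))) atTop (𝓝 0) := by
    refine tendsto_of_tendsto_of_tendsto_of_le_of_le' tendsto_const_nhds h0 ?_ ?_
    · filter_upwards [eventually_gt_atTop 0] with n hn
      have : NeZero n := ⟨hn.ne'⟩
      have h1 := primeProduct_pos n
      have h3 := totient_div_sq_pos n
      have h4 := sub_nonneg.2 (coprimeSum_le n)
      positivity
    · filter_upwards [eventually_gt_atTop 0] with n hn
      have : NeZero n := ⟨hn.ne'⟩
      have h1 := primeProduct_pos n
      have h3 := totient_div_sq_pos n
      have h4 := sub_nonneg.2 (coprimeSum_le n)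
      exact mul_le_mul_of_nonneg_left (mul_le_mul (inv_primeProduct_le n)
        (add_le_add (sub_coprimeSum_le n) (totient_div_sq_le n)) (by positivity) (by positivity))
        (by positivity)
  have h2 := h1.const_sub (6 / Real.pi + Real.pi)
  rw [sub_zero] at h2
  exact h2.congr fun n => (saddleRate_eq n).symm

lemma tendsto_cylinderRate : Tendsto cylinderRate atTop (𝓝 (6 / Real.pi)) := by
  have h0 : Tendsto (fun n : ℕ => 1 / (n : ℝ) * (Real.pi ^ 2 / 6)) atTop (𝓝 0) := by
    simpa using (tendsto_one_div_atTop_nhds_zero_nat (𝕜 := ℝ)).mul_const (Real.pi ^ 2 / 6)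
  have h1 : Tendsto (fun n : ℕ => (Nat.totient n : ℝ) / (2 * (n : ℝ) ^ 2) * (primeProduct n)⁻¹)
      atTop (𝓝 0) := by
    refine tendsto_of_tendsto_of_tendsto_of_le_of_le' tendsto_const_nhds h0 ?_ ?_
    · filter_upwards with n
      have h1 := primeProduct_pos n
      positivity
    · filter_upwards [eventually_gt_atTop 0] with n hn
      have : NeZero n := ⟨hn.ne'⟩
      have h1 := primeProduct_pos n
      refine mul_le_mul (le_trans ?_ (totient_div_sq_le n)) (inv_primeProduct_le n)
        (by positivity) (by positivity)
      have hn' : (0 : ℝ) < n := by exact_mod_cast hn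
      exact div_le_div_of_nonneg_left (by positivity) (by positivity)
        (by linarith [sq_nonneg (n : ℝ)])
  have h2 := (h1.const_sub 1).const_mul (6 / Real.pi)
  rw [sub_zero, mul_one] at h2
  exact h2

lemma card_coprime_Ico {n : ℕ} (hn : 2 ≤ n) :
    ((Finset.Ico 1 n).filter (fun i => Nat.gcd i n = 1)).card = Nat.totient n := by
  rw [Nat.totient_eq_card_coprime]
  congr 1
  ext i
  simp only [Finset.mem_filter, Finset.mem_Ico, Finset.mem_range, Nat.Coprime,
    Nat.gcd_comm n i]
  constructor
  · rintro ⟨⟨_, h⟩, h'⟩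
    exact ⟨h, h'⟩
  · rintro ⟨h, h'⟩
    refine ⟨⟨Nat.pos_of_ne_zero ?_, h⟩, h'⟩
    rintro rfl
    rw [Nat.gcd_zero_left] at h'
    omega

lemma saddleRate_eq_sum_sub {n : ℕ} (hn : 2 ≤ n) : saddleRate n =
    6 / Real.pi * (1 + (∏ p ∈ n.primeFactors, (1 - 1 / (p : ℝ) ^ 2))⁻¹ *
      ∑ i ∈ (Finset.Ico 1 n).filter (fun i => Nat.gcd i n = 1),
        (1 / (i : ℝ) ^ 2 - 1 / (n : ℝ) ^ 2)) := by
  rw [Finset.sum_sub_distrib, Finset.sum_const, card_coprime_Ico hn, nsmul_eq_mul, mul_one_div]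
  rfl

/-- Factor `1 - 1/p² = (1 - 1/p)(1 + 1/p)`; the first factors cancel against `φ(n) = n ∏ (1 - 1/p)`.
-/
lemma cylinderRate_eq_prod_add {n : ℕ} (hn : 2 ≤ n) : cylinderRate n =
    6 / Real.pi * (1 - 1 / (2 * (n : ℝ)) * (∏ p ∈ n.primeFactors, (1 + 1 / (p : ℝ)))⁻¹) := by
  have hn' : (n : ℝ) ≠ 0 := by exact_mod_cast (by omega : n ≠ 0)
  have h1 : (Nat.totient n : ℝ) = n * ∏ p ∈ n.primeFactors, (1 - 1 / (p : ℝ)) := by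
    have h := congrArg (fun q : ℚ => (q : ℝ)) (Nat.totient_eq_mul_prod_factors n)
    push_cast at h
    simpa [one_div] using h
  have h2 : primeProduct n = (∏ p ∈ n.primeFactors, (1 - 1 / (p : ℝ))) *
      ∏ p ∈ n.primeFactors, (1 + 1 / (p : ℝ)) := by
    rw [primeProduct, ← Finset.prod_mul_distrib]
    refine Finset.prod_congr rfl fun p _ => by ring
  have h3 := (primeProduct_pos n).ne'
  rw [h2] at h3
  have h4 := left_ne_zero_of_mul h3
  have h5 := right_ne_zero_of_mul h3
  rw [cylinderRate, h1, h2]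
  congr 2
  field_simp

/-! ### Rational points as torsion points -/

lemma isRationalPoint_of_nsmul_eq_zero {x : Torus} {k : ℕ} (hk : 0 < k) (h : k • x = 0) :
    IsRationalPoint x := by
  obtain ⟨X, rfl⟩ := torusProj_surjective x
  have h1 : torusProj ((k : ℝ) • X) = 0 := by
    rw [← h]
    ext i
    simp only [torusProj_apply, PiLp.smul_apply, smul_eq_mul, Pi.smul_apply]
    rw [← AddCircle.coe_nsmul, nsmul_eq_mul]
  obtain ⟨m, hm⟩ := torusProj_eq_zero_iff.1 h1
  have hk' : (k : ℝ) ≠ 0 := by exact_mod_cast hk.ne'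
  have h2 := congrArg (fun v : EuclideanSpace ℝ (Fin 2) => v 0) hm
  have h3 := congrArg (fun v : EuclideanSpace ℝ (Fin 2) => v 1) hm
  simp at h2 h3
  refine ⟨m.1 / k, m.2 / k, congrArg torusProj (plane_ext ?_ ?_)⟩
  · simp [← h2, hk']
  · simp [← h3, hk']

/-- The coordinates are put over a common denominator `N` and the gcd of both numerators and `N` is
cancelled. Denominator `1` would mean `x = 0`. -/
lemma exists_torsion_representation {x : Torus} (hx : IsRationalPoint x) (h0 : x ≠ 0) :
    ∃ (n : ℕ) (p : ℤ × ℤ), 2 ≤ n ∧ Nat.gcd (Int.gcd p.1 p.2) n = 1 ∧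
      x = torusProj !₂[(p.1 : ℝ) / n, (p.2 : ℝ) / n] := by
  obtain ⟨q₁, q₂, rfl⟩ := hx
  set a : ℤ := q₁.num * q₂.den with ha
  set b : ℤ := q₂.num * q₁.den with hb
  set N : ℕ := q₁.den * q₂.den with hN
  have hNpos : 0 < N := Nat.mul_pos q₁.den_pos q₂.den_pos
  set g : ℕ := Nat.gcd (Int.gcd a b) N with hg
  have hgpos : 0 < g := Nat.gcd_pos_of_pos_right _ hNpos
  have hgab : (g : ℤ) ∣ Int.gcd a b := Int.natCast_dvd_natCast.2 (Nat.gcd_dvd_left _ _)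
  obtain ⟨a', ha'⟩ := hgab.trans (Int.gcd_dvd_left ..)
  obtain ⟨b', hb'⟩ := hgab.trans (Int.gcd_dvd_right ..)
  obtain ⟨n, hn⟩ := Nat.gcd_dvd_right (Int.gcd a b) N
  rw [← hg] at hn
  have hnpos : 0 < n := Nat.pos_of_mul_pos_left (hn ▸ hNpos)
  have hgr : (g : ℝ) ≠ 0 := by exact_mod_cast hgpos.ne'
  have hnr : (n : ℝ) ≠ 0 := by exact_mod_cast hnpos.ne'
  have hNr : (N : ℝ) = g * n := by exact_mod_cast hn
  have d1 : (q₁.den : ℝ) ≠ 0 := by exact_mod_cast q₁.den_pos.ne'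
  have d2 : (q₂.den : ℝ) ≠ 0 := by exact_mod_cast q₂.den_pos.ne'
  have e1 : (q₁ : ℝ) = a' / n := by
    have h1 : (a : ℝ) = g * a' := by exact_mod_cast ha'
    have h2 : (q₁ : ℝ) = a / N := by
      rw [Rat.cast_def, ha, hN]; push_cast; field_simp
    rw [h2, h1, hNr, mul_div_mul_left _ _ hgr]
  have e2 : (q₂ : ℝ) = b' / n := by
    have h1 : (b : ℝ) = g * b' := by exact_mod_cast hb'
    have h2 : (q₂ : ℝ) = b / N := by
      rw [Rat.cast_def, hb, hN]; push_cast; field_simp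
    rw [h2, h1, hNr, mul_div_mul_left _ _ hgr]
  refine ⟨n, (a', b'), ?_, ?_, by rw [e1, e2]⟩
  · by_contra hlt
    have hn1 : n = 1 := by omega
    refine h0 ?_
    rw [torusProj_eq_zero_iff, e1, e2, hn1]
    exact ⟨(a', b'), plane_ext (by simp) (by simp)⟩
  · have h1 : g = Nat.gcd (g * Int.gcd a' b') (g * n) := by
      conv_lhs => rw [hg, hn, ha', hb', Int.gcd_mul_left, Int.natAbs_natCast]
    rw [Nat.gcd_mul_left] at h1
    exact Nat.eq_of_mul_eq_mul_left hgpos (by rw [← h1, mul_one])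

/-! ### From counting functions to growth rates -/

lemma neg_mem_latticeDisc_zero {v : ℤ × ℤ} {T : ℝ} (h : v ∈ latticeDisc 0 T) :
    -v ∈ latticeDisc 0 T := by
  rw [mem_latticeDisc_zero] at h ⊢
  simpa using h

lemma ncard_primitive_eq_two_mul (T : ℝ) : (latticeDisc 0 T ∩ primitiveVectors).ncard =
    2 * (latticeDisc 0 T ∩ positivePrimitiveVectors).ncard := by
  rw [ncard_eq_two_mul_ncard_positive ((latticeDisc_finite _ _).inter_of_left _)
    Set.inter_subset_right
    fun v hv => ⟨neg_mem_latticeDisc_zero hv.1, neg_mem_primitiveVectors hv.2⟩, Set.inter_assoc,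
    Set.inter_eq_right.2 positivePrimitiveVectors_subset]

lemma ncard_primitive_eq_aligned_add (x : Torus) (T : ℝ) :
    (latticeDisc 0 T ∩ primitiveVectors).ncard = (latticeDisc 0 T ∩ alignedVectors x).ncard +
      2 * (latticeDisc 0 T ∩ (positivePrimitiveVectors \ alignedVectors x)).ncard := by
  have hfin : ∀ Q : Set (ℤ × ℤ), (latticeDisc 0 T ∩ Q).Finite :=
    fun Q => (latticeDisc_finite 0 T).inter_of_left Q
  have h1 : (latticeDisc 0 T ∩ (primitiveVectors \ alignedVectors x)).ncard =
      2 * (latticeDisc 0 T ∩ (positivePrimitiveVectors \ alignedVectors x)).ncard := by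
    have hsub : latticeDisc 0 T ∩ (primitiveVectors \ alignedVectors x) ⊆ primitiveVectors :=
      fun v hv => hv.2.1
    rw [ncard_eq_two_mul_ncard_positive (hfin _) hsub
      fun v hv => ⟨neg_mem_latticeDisc_zero hv.1, neg_mem_primitiveVectors hv.2.1, fun h =>
        hv.2.2 ⟨hv.2.1, by simpa [transverse_neg] using h.2⟩⟩]
    congr 2
    ext v
    simp only [Set.mem_inter_iff, Set.mem_sdiff]
    constructor
    · rintro ⟨⟨h1, _, h2⟩, h3⟩; exact ⟨h1, h3, h2⟩
    · rintro ⟨h1, h3, h2⟩; exact ⟨⟨h1, h3.1, h2⟩, h3⟩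
  rw [← h1, ← Set.ncard_union_eq _ (hfin _) (hfin _), ← Set.inter_union_distrib_left,
    Set.union_sdiff_cancel fun v hv => hv.1]
  rw [Set.disjoint_left]
  exact fun v hv hv' => hv'.2.2 hv.2

lemma tendsto_ncard_positive :
    Tendsto (fun T : ℝ => ((latticeDisc 0 T ∩ positivePrimitiveVectors).ncard : ℝ) / T ^ 2) atTop
      (𝓝 (6 / Real.pi / 2)) := by
  refine (ncard_primitive_tendsto.div_const 2).congr fun T => ?_
  rw [ncard_primitive_eq_two_mul]
  push_cast
  ring

lemma tendsto_ncard_not_aligned {x : Torus} {a : ℝ}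
    (ha : Tendsto (fun T : ℝ => ((latticeDisc 0 T ∩ alignedVectors x).ncard : ℝ) / T ^ 2) atTop
      (𝓝 a)) :
    Tendsto (fun T : ℝ =>
      ((latticeDisc 0 T ∩ (positivePrimitiveVectors \ alignedVectors x)).ncard : ℝ) / T ^ 2) atTop
      (𝓝 ((6 / Real.pi - a) / 2)) := by
  refine ((ncard_primitive_tendsto.sub ha).div_const 2).congr fun T => ?_
  rw [ncard_primitive_eq_aligned_add x]
  push_cast
  ring

/-- Since `a` counts both signs, half of it is lost: an aligned direction gives one cylinder instead
of two. -/
lemma tendsto_Npo {x : Torus} {a : ℝ}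
    (ha : Tendsto (fun T : ℝ => ((latticeDisc 0 T ∩ alignedVectors x).ncard : ℝ) / T ^ 2) atTop
      (𝓝 a)) :
    Tendsto (fun T : ℝ => (Npo x T : ℝ) / T ^ 2) atTop (𝓝 (6 / Real.pi - a / 2)) := by
  have h := tendsto_ncard_positive.add (tendsto_ncard_not_aligned ha)
  rw [show 6 / Real.pi / 2 + (6 / Real.pi - a) / 2 = 6 / Real.pi - a / 2 by ring] at h
  refine h.congr' ?_
  filter_upwards [eventually_gt_atTop 0] with T hT
  rw [Npo_eq x hT, Nat.cast_add, add_div]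

/-- An aligned direction loses both its loops, so here the whole of `a` is subtracted; `b` accounts
for the arcs from `0` to `x`. -/
lemma tendsto_Nsc {X : EuclideanSpace ℝ (Fin 2)} (hX : torusProj X ≠ 0) {a b : ℝ}
    (ha : Tendsto (fun T : ℝ => ((latticeDisc 0 T ∩ alignedVectors (torusProj X)).ncard : ℝ) / T ^ 2)
      atTop (𝓝 a))
    (hb : Tendsto (fun T : ℝ => ((latticeDisc (X 0, X 1) T ∩ visibleShifts X).ncard : ℝ) / T ^ 2)
      atTop (𝓝 b)) :
    Tendsto (fun T : ℝ => (Nsc (torusProj X) T : ℝ) / T ^ 2) atTop (𝓝 (6 / Real.pi - a + b)) := by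
  have h := ((tendsto_ncard_not_aligned ha).const_mul 2).add hb
  rw [mul_div_cancel₀ _ two_ne_zero] at h
  refine h.congr' ?_
  filter_upwards [eventually_gt_atTop 0] with T hT
  rw [Nsc_eq hX hT]
  push_cast
  ring

lemma alignedVectors_zero : alignedVectors 0 = primitiveVectors := by
  ext v; simp [alignedVectors]

lemma tendsto_Nsc_zero :
    Tendsto (fun T : ℝ => (Nsc 0 T : ℝ) / T ^ 2) atTop (𝓝 (3 / Real.pi)) := by
  have h := tendsto_ncard_positive
  rw [show 6 / Real.pi / 2 = 3 / Real.pi by ring] at h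
  refine h.congr' ?_
  filter_upwards [eventually_gt_atTop 0] with T hT
  rw [Nsc_zero_eq hT]

lemma tendsto_Npo_zero :
    Tendsto (fun T : ℝ => (Npo 0 T : ℝ) / T ^ 2) atTop (𝓝 (3 / Real.pi)) := by
  have h := tendsto_Npo (x := 0) (a := 6 / Real.pi)
    (by rw [alignedVectors_zero]; exact ncard_primitive_tendsto)
  rwa [show 6 / Real.pi - 6 / Real.pi / 2 = 3 / Real.pi by ring] at h

/-! ### Non-rational points -/

section NonRational

/-- Two independent aligned vectors give a linear system for `X` with integer coefficients and
right-hand sides; Cramer's rule then makes `X` rational. -/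
lemma parallel_of_aligned {x : Torus} (hx : ¬ IsRationalPoint x) {v w : ℤ × ℤ}
    (hv : v ∈ alignedVectors x) (hw : w ∈ alignedVectors x) : w = v ∨ w = -v := by
  refine eq_or_eq_neg_of_parallel hv.1 hw.1 ?_
  by_contra hne
  obtain ⟨X, rfl⟩ := torusProj_surjective x
  have h1 := hv.2
  have h2 := hw.2
  rw [transverse_torusProj, unitAddCircle_coe_eq_zero_iff] at h1 h2
  obtain ⟨k, hk⟩ := h1
  obtain ⟨l, hl⟩ := h2
  have hD : (v.1 * w.2 - v.2 * w.1 : ℝ) ≠ 0 := by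
    rw [sub_ne_zero]; exact_mod_cast hne
  refine hx ⟨(k * w.1 - l * v.1 : ℚ) / (v.1 * w.2 - v.2 * w.1),
    (k * w.2 - l * v.2 : ℚ) / (v.1 * w.2 - v.2 * w.1), congrArg torusProj (plane_ext ?_ ?_)⟩
  · push_cast
    refine (eq_div_iff hD).2 ?_
    linear_combination w.1 * hk - v.1 * hl
  · push_cast
    refine (eq_div_iff hD).2 ?_
    linear_combination w.2 * hk - v.2 * hl

lemma tendsto_ncard_aligned_of_nonrational {x : Torus} (hx : ¬ IsRationalPoint x) :
    Tendsto (fun T : ℝ => ((latticeDisc 0 T ∩ alignedVectors x).ncard : ℝ) / T ^ 2) atTop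
      (𝓝 0) := by
  have hle : ∀ T : ℝ, (latticeDisc 0 T ∩ alignedVectors x).ncard ≤ 2 := by
    intro T
    rcases (alignedVectors x).eq_empty_or_nonempty with h | ⟨v, hv⟩
    · simp [h]
    · refine (Set.ncard_le_ncard (t := {v, -v}) ?_ (by simp)).trans (Set.ncard_insert_le _ _ |>.trans ?_)
      · exact fun w hw => parallel_of_aligned hx hv hw.2
      · simp
  refine tendsto_of_tendsto_of_tendsto_of_le_of_le tendsto_const_nhds
    ((tendsto_const_nhds (x := (2 : ℝ))).div_atTop (tendsto_pow_atTop two_ne_zero))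
    (fun T => by positivity) fun T => ?_
  dsimp only
  gcongr
  exact_mod_cast hle T

/-- An obstruction of the arc by `x` at `s` is one by `0` at `1 - s`. Some `t (X + m)` is thus a
non-zero integer vector, and its primitive direction carries `0` and `x` on one leaf. -/
lemma exists_aligned_of_notMem_visibleShifts {X : EuclideanSpace ℝ (Fin 2)}
    (hX : torusProj X ≠ 0) {m : ℤ × ℤ} (hm : m ∉ visibleShifts X) :
    ∃ v ∈ alignedVectors (torusProj X), (v.1 : ℝ) * (X 1 + m.2) = v.2 * (X 0 + m.1) := by
  have hproj : torusProj (X + intVec m) = torusProj X := by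
    rw [torusProj_add, torusProj_intVec, add_zero]
  obtain ⟨t, ht, h⟩ : ∃ t ∈ Set.Ioo (0 : ℝ) 1, torusProj (t • (X + intVec m)) = 0 := by
    have hm' : ¬ ∀ s ∈ Set.Ioo (0 : ℝ) 1, torusProj (s • (X + intVec m)) ≠ 0 ∧
      torusProj (s • (X + intVec m)) ≠ torusProj X := hm
    push Not at hm'
    obtain ⟨s, hs, h⟩ := hm'
    by_cases h0 : torusProj (s • (X + intVec m)) = 0
    · exact ⟨s, hs, h0⟩
    · refine ⟨1 - s, ⟨by linarith [hs.2], by linarith [hs.1]⟩, ?_⟩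
      rw [sub_smul, one_smul, torusProj_sub, hproj, h h0, sub_self]
  obtain ⟨k, hk⟩ := torusProj_eq_zero_iff.1 h
  have h0 := congrArg (fun v : EuclideanSpace ℝ (Fin 2) => v 0) hk
  have h1 := congrArg (fun v : EuclideanSpace ℝ (Fin 2) => v 1) hk
  simp only [PiLp.smul_apply, PiLp.add_apply, intVec_apply_zero, intVec_apply_one,
    smul_eq_mul] at h0 h1
  have hk0 : k ≠ 0 := by
    rintro rfl
    refine hX ?_
    rw [← hproj, ← torusProj_zero]
    have ht0 := ht.1.ne'
    congr 1
    apply plane_ext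
    · simpa [ht0] using h0
    · simpa [ht0] using h1
  obtain ⟨v, hv, g, hg, rfl⟩ := exists_primitive_smul hk0
  have hpar : (v.1 : ℝ) * (X 1 + m.2) = v.2 * (X 0 + m.1) := by
    refine mul_left_cancel₀ ht.1.ne' ?_
    push_cast at h0 h1
    linear_combination (v.1 : ℝ) * h1 - v.2 * h0
  refine ⟨v, ⟨hv, ?_⟩, hpar⟩
  rw [← hproj, transverse_torusProj]
  simp only [PiLp.add_apply, intVec_apply_zero, intVec_apply_one]
  rw [sub_eq_zero.2 hpar]
  simp

lemma card_Icc_ceil_floor_le (y : ℝ) {T : ℝ} (hT : 0 < T) :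
    ((Finset.Icc ⌈-T - y⌉ ⌊T - y⌋).card : ℝ) ≤ 2 * T + 1 := by
  rw [Int.card_Icc]
  have h : (((⌊T - y⌋ + 1 - ⌈-T - y⌉).toNat : ℤ) : ℝ) ≤ 2 * T + 1 := by
    rw [Int.toNat_eq_max]
    push_cast
    refine max_le ?_ (by linarith)
    linarith [Int.floor_le (T - y), Int.le_ceil (-T - y)]
  exact_mod_cast h

/-- A line through the centre of the shifted disc projects injectively to one of the axes. -/
lemma ncard_line_le (y : ℝ × ℝ) {v : ℤ × ℤ} (hv : v ≠ 0) {T : ℝ} (hT : 0 < T) :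
    ((latticeDisc y T ∩ {m | (v.1 : ℝ) * (y.2 + m.2) = v.2 * (y.1 + m.1)}).ncard : ℝ) ≤
      2 * T + 1 := by
  have hsub := latticeDisc_subset y T
  rw [abs_of_pos hT] at hsub
  by_cases h1 : (v.1 : ℝ) = 0
  · have h2 : (v.2 : ℝ) ≠ 0 := fun h2 =>
      hv (Prod.ext (by exact_mod_cast h1) (by exact_mod_cast h2))
    refine le_trans ?_ (card_Icc_ceil_floor_le y.2 hT)
    rw [← Set.ncard_coe_finset]
    refine Nat.cast_le.2 (Set.ncard_le_ncard_of_injOn Prod.snd ?_ ?_ (Finset.finite_toSet _))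
    · intro m hm
      have := hsub hm.1
      rw [Finset.coe_product] at this
      exact this.2
    · rintro ⟨a, b⟩ ⟨_, h⟩ ⟨c, d⟩ ⟨_, h'⟩ hbd
      simp only [Set.mem_ofPred_eq, h1, zero_mul, zero_eq_mul, h2, false_or] at h h' hbd
      have : (a : ℝ) = c := by linarith
      exact Prod.ext (by exact_mod_cast this) hbd
  · refine le_trans ?_ (card_Icc_ceil_floor_le y.1 hT)
    rw [← Set.ncard_coe_finset]
    refine Nat.cast_le.2 (Set.ncard_le_ncard_of_injOn Prod.fst ?_ ?_ (Finset.finite_toSet _))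
    · intro m hm
      have := hsub hm.1
      rw [Finset.coe_product] at this
      exact this.1
    · rintro ⟨a, b⟩ ⟨_, h⟩ ⟨c, d⟩ ⟨_, h'⟩ hbd
      simp only [Set.mem_ofPred_eq] at h h' hbd
      subst hbd
      have := mul_left_cancel₀ h1 (h.trans h'.symm)
      have : (b : ℝ) = d := by linarith
      exact Prod.ext rfl (by exact_mod_cast this)

/-- The only possible aligned direction confines all obstructed shifts to one line, so they number
`O(T)`. -/
lemma tendsto_ncard_visible_of_nonrational {X : EuclideanSpace ℝ (Fin 2)}
    (hX : ¬ IsRationalPoint (torusProj X)) :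
    Tendsto (fun T : ℝ => ((latticeDisc (X 0, X 1) T ∩ visibleShifts X).ncard : ℝ) / T ^ 2)
      atTop (𝓝 Real.pi) := by
  have hX0 : torusProj X ≠ 0 := by
    intro h
    refine hX (isRationalPoint_of_nsmul_eq_zero one_pos ?_)
    rw [h, smul_zero]
  have hinv : ∀ T : ℝ, 0 < T →
      ((latticeDisc (X 0, X 1) T \ visibleShifts X).ncard : ℝ) ≤ 2 * T + 1 := by
    intro T hT
    rcases (alignedVectors (torusProj X)).eq_empty_or_nonempty with h | ⟨v, hv⟩
    · have : latticeDisc (X 0, X 1) T \ visibleShifts X = ∅ := by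
        refine Set.eq_empty_of_forall_notMem fun m hm => ?_
        obtain ⟨v, hv, _⟩ := exists_aligned_of_notMem_visibleShifts hX0 hm.2
        rw [h] at hv
        exact hv
      rw [this, Set.ncard_empty]
      push_cast
      linarith
    · refine le_trans ?_ (ncard_line_le (X 0, X 1) (primitiveVectors_ne_zero hv.1) hT)
      refine Nat.cast_le.2 (Set.ncard_le_ncard ?_ ((latticeDisc_finite _ _).inter_of_left _))
      rintro m ⟨hm, hm'⟩
      refine ⟨hm, ?_⟩
      obtain ⟨w, hw, h⟩ := exists_aligned_of_notMem_visibleShifts hX0 hm'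
      rcases parallel_of_aligned hX hv hw with rfl | rfl
      · exact h
      · simp only [Prod.fst_neg, Prod.snd_neg, Int.cast_neg, neg_mul, neg_inj] at h
        exact h
  have hsplit : ∀ T : ℝ, ((latticeDisc (X 0, X 1) T).ncard : ℝ) =
      (latticeDisc (X 0, X 1) T ∩ visibleShifts X).ncard +
        (latticeDisc (X 0, X 1) T \ visibleShifts X).ncard := by
    intro T
    exact_mod_cast (Set.ncard_inter_add_ncard_sdiff_eq_ncard _ _ (latticeDisc_finite _ _)).symm
  have hzero : Tendsto (fun T : ℝ => ((latticeDisc (X 0, X 1) T \ visibleShifts X).ncard : ℝ) / T ^ 2)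
      atTop (𝓝 0) := by
    have hlim : Tendsto (fun T : ℝ => 3 / T) atTop (𝓝 0) := tendsto_const_nhds.div_atTop tendsto_id
    refine tendsto_of_tendsto_of_tendsto_of_le_of_le' tendsto_const_nhds hlim
      (Eventually.of_forall fun T => by positivity) ?_
    filter_upwards [eventually_ge_atTop 1] with T hT
    have hT0 : 0 < T := by linarith
    rw [div_le_div_iff₀ (by positivity) hT0]
    nlinarith [hinv T hT0]
  have h := (ncard_latticeDisc_tendsto (X 0, X 1)).sub hzero
  rw [sub_zero] at h
  refine h.congr fun T => ?_
  rw [hsplit]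
  ring

end NonRational

/-! ### Torsion points -/

/-- The representative in the plane of the `n`-torsion point with numerators `p`. -/
noncomputable def torsionVector (n : ℕ) (p : ℤ × ℤ) : EuclideanSpace ℝ (Fin 2) :=
  !₂[(p.1 : ℝ) / n, (p.2 : ℝ) / n]

@[simp] lemma torsionVector_zero (n : ℕ) (p : ℤ × ℤ) : torsionVector n p 0 = (p.1 : ℝ) / n := rfl
@[simp] lemma torsionVector_one (n : ℕ) (p : ℤ × ℤ) : torsionVector n p 1 = (p.2 : ℝ) / n := rfl

lemma ncard_biUnion_finset {α ι : Type*} (K : Finset ι) {S : ι → Set α}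
    (hS : ∀ i ∈ K, (S i).Finite) (hd : (K : Set ι).PairwiseDisjoint S) :
    (⋃ i ∈ K, S i).ncard = ∑ i ∈ K, (S i).ncard := by
  have h := K.finite_toSet.ncard_biUnion hS hd
  rwa [finsum_mem_coe_finset] at h

lemma gcd_mul_gcd_eq_one {n : ℕ} {p : ℤ × ℤ} (hp : Nat.gcd (Int.gcd p.1 p.2) n = 1) {k : ℤ}
    (hk : IsCoprime k n) : Nat.gcd (Int.gcd (k * p.1) (k * p.2)) n = 1 := by
  rw [Int.gcd_mul_left]
  exact Nat.Coprime.mul_left (Int.isCoprime_iff_gcd_eq_one.1 hk) hp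

lemma exists_bezout_mod {n : ℕ} {p : ℤ × ℤ} (hp : Nat.gcd (Int.gcd p.1 p.2) n = 1) :
    ∃ γ δ ε : ℤ, γ * p.1 + δ * p.2 + ε * n = 1 := by
  obtain ⟨a, b, h⟩ := Nat.isCoprime_iff_coprime.2 hp
  refine ⟨a * Int.gcdA p.1 p.2, a * Int.gcdB p.1 p.2, b, ?_⟩
  rw [Int.gcd_eq_gcd_ab] at h
  linear_combination h

lemma modEq_of_mul_modEq {n : ℕ} {p : ℤ × ℤ} (hp : Nat.gcd (Int.gcd p.1 p.2) n = 1) {k l : ℤ}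
    (h1 : k * p.1 ≡ l * p.1 [ZMOD n]) (h2 : k * p.2 ≡ l * p.2 [ZMOD n]) : k ≡ l [ZMOD n] := by
  obtain ⟨γ, δ, ε, h⟩ := exists_bezout_mod hp
  obtain ⟨a, ha⟩ := h1.dvd
  obtain ⟨b, hb⟩ := h2.dvd
  refine Int.modEq_iff_dvd.2 ⟨γ * a + δ * b + ε * (l - k), ?_⟩
  linear_combination γ * ha + δ * hb - (l - k) * h

lemma transverse_torsion_eq_zero_iff {n : ℕ} (hn : 0 < n) {p v : ℤ × ℤ} :
    transverse v (torusProj (torsionVector n p)) = 0 ↔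
      (n : ℤ) ∣ v.1 * p.2 - v.2 * p.1 := by
  have hn' : (n : ℝ) ≠ 0 := by exact_mod_cast hn.ne'
  rw [transverse_torusProj, unitAddCircle_coe_eq_zero_iff]
  simp only [torsionVector_zero, torsionVector_one]
  refine exists_congr fun k => ?_
  rw [← Int.cast_inj (α := ℝ)]
  push_cast
  field_simp

/-- Alignment means `n ∣ det(v, p)`. As `p` is unimodular modulo `n`, this makes `v` a multiple of
`p` modulo `n`, and primitivity of `v` makes the factor a unit. -/
lemma aligned_torsion_eq {n : ℕ} (hn : 0 < n) {p : ℤ × ℤ}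
    (hp : Nat.gcd (Int.gcd p.1 p.2) n = 1) :
    alignedVectors (torusProj (torsionVector n p)) =
      ⋃ k ∈ (Finset.range n).filter (fun k => n.Coprime k),
        primitiveVectors ∩ residueClass n ((k : ℤ) * p.1, (k : ℤ) * p.2) := by
  ext v
  simp only [alignedVectors, Set.mem_ofPred_eq, Set.mem_iUnion, Finset.mem_filter,
    Finset.mem_range, Set.mem_inter_iff, exists_prop]
  rw [transverse_torsion_eq_zero_iff hn]
  constructor
  · rintro ⟨hv, j, hj⟩
    obtain ⟨γ, δ, ε, h⟩ := exists_bezout_mod hp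
    obtain ⟨α, β, hab⟩ := exists_bezout hv
    have hnz : (n : ℤ) ≠ 0 := by exact_mod_cast hn.ne'
    -- The functional `(γ, δ)` takes the value `1` on `p` modulo `n`, so it reads off the factor.
    set k : ℤ := γ * v.1 + δ * v.2 with hk
    have e1 : v.1 - k * p.1 = n * (ε * v.1 + δ * j) := by
      rw [hk]; linear_combination -v.1 * h + δ * hj
    have e2 : v.2 - k * p.2 = n * (ε * v.2 - γ * j) := by
      rw [hk]; linear_combination -v.2 * h - γ * hj
    have hco : IsCoprime k n := by
      refine ⟨α * p.1 + β * p.2, α * (ε * v.1 + δ * j) + β * (ε * v.2 - γ * j), ?_⟩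
      linear_combination hab - α * e1 - β * e2
    have hr : ((k % n).toNat : ℤ) = k % n := Int.toNat_of_nonneg (Int.emod_nonneg _ hnz)
    have hmod : ((k % n).toNat : ℤ) ≡ k [ZMOD n] := by rw [hr]; exact Int.mod_modEq k n
    refine ⟨(k % n).toNat, ⟨?_, ?_⟩, hv, ?_, ?_⟩
    · have := Int.emod_lt_of_pos k (by exact_mod_cast hn : (0 : ℤ) < n)
      omega
    · rw [← Nat.isCoprime_iff_coprime, hr, Int.emod_def]
      have := (hco.add_mul_left_left (-(k / n))).symm
      rwa [mul_neg, ← sub_eq_add_neg] at this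
    · exact ((hmod.mul_right p.1).trans (Int.modEq_iff_dvd.2 ⟨_, e1⟩)).symm
    · exact ((hmod.mul_right p.2).trans (Int.modEq_iff_dvd.2 ⟨_, e2⟩)).symm
  · rintro ⟨k, ⟨_, _⟩, hv, h1, h2⟩
    refine ⟨hv, ?_⟩
    have h3 := ((h1.mul_right p.2).sub (h2.mul_right p.1)).symm.dvd
    simp only at h3
    rwa [show v.1 * p.2 - v.2 * p.1 - (k * p.1 * p.2 - k * p.2 * p.1) =
      v.1 * p.2 - v.2 * p.1 by ring] at h3

lemma tendsto_ncard_aligned_torsion {n : ℕ} (hn : 0 < n) {p : ℤ × ℤ}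
    (hp : Nat.gcd (Int.gcd p.1 p.2) n = 1) :
    Tendsto (fun T : ℝ =>
      ((latticeDisc 0 T ∩ alignedVectors (torusProj (torsionVector n p))).ncard : ℝ) / T ^ 2) atTop
      (𝓝 (n.totient * primitiveDensity n)) := by
  have hcount : ∀ T : ℝ,
      (latticeDisc 0 T ∩ alignedVectors (torusProj (torsionVector n p))).ncard =
      ∑ k ∈ (Finset.range n).filter (fun k => n.Coprime k), (latticeDisc 0 T ∩
        (primitiveVectors ∩ residueClass n ((k : ℤ) * p.1, (k : ℤ) * p.2))).ncard := by
    intro T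
    rw [aligned_torsion_eq hn hp, Set.inter_iUnion₂, ncard_biUnion_finset]
    · exact fun k _ => (latticeDisc_finite _ _).inter_of_left _
    · intro k hk l hl hkl
      simp only [Finset.coe_filter, Finset.mem_range, Set.mem_ofPred_eq] at hk hl
      refine Set.disjoint_left.2 fun v h h' => hkl ?_
      have h1 := modEq_of_mul_modEq hp (h.2.2.1.symm.trans h'.2.2.1) (h.2.2.2.symm.trans h'.2.2.2)
      exact Nat.ModEq.eq_of_lt_of_lt (Int.natCast_modEq_iff.1 h1) hk.1 hl.1
  have hlim := tendsto_finsetSum ((Finset.range n).filter (fun k => n.Coprime k)) fun k hk =>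
    ncard_primitive_residueClass_tendsto hn (c := ((k : ℤ) * p.1, (k : ℤ) * p.2))
      (gcd_mul_gcd_eq_one hp (Nat.isCoprime_iff_coprime.2 (Finset.mem_filter.1 hk).2).symm)
  rw [Finset.sum_const, ← Nat.totient_eq_card_coprime, nsmul_eq_mul] at hlim
  refine hlim.congr fun T => ?_
  rw [hcount, Nat.cast_sum, Finset.sum_div]

/-- With `p + n m = g v` and `v` primitive, the arc is `(g/n) v`. It meets `0` in its interior
exactly when `g > n`; equality is impossible because `gcd(g, n) = 1` and `n ≥ 2`. Meeting `x` at `s`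
is meeting `0` at `1 - s`. -/
lemma visible_torsion_iff {n : ℕ} (hn : 2 ≤ n) {p : ℤ × ℤ}
    (hp : Nat.gcd (Int.gcd p.1 p.2) n = 1) (m : ℤ × ℤ) :
    (m ∈ visibleShifts (torsionVector n p) ↔ Int.gcd (p.1 + n * m.1) (p.2 + n * m.2) < n) ∧
      0 < Int.gcd (p.1 + n * m.1) (p.2 + n * m.2) ∧
      Nat.gcd (Int.gcd (p.1 + n * m.1) (p.2 + n * m.2)) n = 1 := by
  have hn0 : (0 : ℝ) < n := by exact_mod_cast (by omega : 0 < n)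
  have hco : Nat.gcd (Int.gcd (p.1 + n * m.1) (p.2 + n * m.2)) n = 1 := by
    set d := Nat.gcd (Int.gcd (p.1 + n * m.1) (p.2 + n * m.2)) n with hd
    have hdn : (d : ℤ) ∣ n := Int.natCast_dvd_natCast.2 (Nat.gcd_dvd_right _ _)
    have hdg : (d : ℤ) ∣ Int.gcd (p.1 + n * m.1) (p.2 + n * m.2) :=
      Int.natCast_dvd_natCast.2 (Nat.gcd_dvd_left _ _)
    have h1 := (Int.dvd_add_left (hdn.mul_right m.1)).1 (hdg.trans (Int.gcd_dvd_left ..))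
    have h2 := (Int.dvd_add_left (hdn.mul_right m.2)).1 (hdg.trans (Int.gcd_dvd_right ..))
    have := Nat.dvd_gcd (Int.dvd_gcd h1 h2) (Nat.gcd_dvd_right _ n)
    rw [hp] at this
    exact Nat.dvd_one.1 this
  set g := Int.gcd (p.1 + n * m.1) (p.2 + n * m.2) with hg
  have hgpos : 0 < g := by
    refine Nat.pos_of_ne_zero fun h => ?_
    rw [h, Nat.gcd_zero_left] at hco
    omega
  refine ⟨?_, hgpos, hco⟩
  have hw0 : ((p.1 + n * m.1, p.2 + n * m.2) : ℤ × ℤ) ≠ 0 := by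
    intro h
    have h1 := congrArg Prod.fst h
    have h2 := congrArg Prod.snd h
    simp only [Prod.fst_zero, Prod.snd_zero] at h1 h2
    rw [hg, h1, h2] at hgpos
    simp at hgpos
  obtain ⟨v, hv, g', hg', hw⟩ := exists_primitive_smul hw0
  have hw1 : p.1 + n * m.1 = g' * v.1 := congrArg Prod.fst hw
  have hw2 : p.2 + n * m.2 = g' * v.2 := congrArg Prod.snd hw
  have hgg : g = g' := by
    have hv' : Int.gcd v.1 v.2 = 1 := hv
    rw [hg, hw1, hw2, Int.gcd_mul_left, hv', mul_one, Int.natAbs_natCast]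
  rw [← hgg] at hw1 hw2
  have hg0 : (0 : ℝ) < g := by exact_mod_cast hgpos
  have hvec : torsionVector n p + intVec m = ((g : ℝ) / n) • intVec v := by
    have r1 : (p.1 + n * m.1 : ℝ) = g * v.1 := by exact_mod_cast hw1
    have r2 : (p.2 + n * m.2 : ℝ) = g * v.2 := by exact_mod_cast hw2
    apply plane_ext
    · simp only [PiLp.add_apply, PiLp.smul_apply, torsionVector_zero, intVec_apply_zero,
        smul_eq_mul]
      field_simp
      linarith
    · simp only [PiLp.add_apply, PiLp.smul_apply, torsionVector_one, intVec_apply_one,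
        smul_eq_mul]
      field_simp
      linarith
  have hproj : torusProj (torsionVector n p) = torusProj (((g : ℝ) / n) • intVec v) := by
    rw [← hvec, torusProj_add, torusProj_intVec, add_zero]
  have hmem : m ∈ visibleShifts (torsionVector n p) ↔ ∀ s ∈ Set.Ioo (0 : ℝ) 1,
      torusProj ((s * (g / n)) • intVec v) ≠ 0 ∧
      torusProj (((1 - s) * (g / n)) • intVec v) ≠ 0 := by
    simp only [visibleShifts, Set.mem_ofPred_eq, hvec, hproj, smul_smul]
    refine forall₂_congr fun s _ => and_congr Iff.rfl (not_congr ?_)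
    rw [← sub_eq_zero, ← torusProj_sub, ← sub_smul, ← neg_eq_zero, ← torusProj_neg, ← neg_smul]
    ring_nf
  rw [hmem]
  constructor
  · intro h
    by_contra hlt
    have hne : g ≠ n := by
      intro h
      rw [h, Nat.gcd_self] at hco
      omega
    have hgn : (n : ℝ) < g := by exact_mod_cast lt_of_le_of_ne (not_lt.1 hlt) hne.symm
    -- At `s = n/g` the arc has covered exactly `v`.
    refine (h (n / g) ⟨by positivity, (div_lt_one hg0).2 hgn⟩).1 ?_
    rw [div_mul_div_cancel₀ hg0.ne', div_self hn0.ne', one_smul, torusProj_intVec]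
  · intro h s hs
    have h1 : (g : ℝ) / n < 1 := (div_lt_one hn0).2 (by exact_mod_cast h)
    have h2 : (0 : ℝ) < g / n := by positivity
    have aux : ∀ s ∈ Set.Ioo (0 : ℝ) 1, torusProj ((s * (g / n)) • intVec v) ≠ 0 := fun s hs =>
      torusProj_smul_intVec_ne_zero hv ⟨mul_pos hs.1 h2, by nlinarith [hs.1, hs.2]⟩
    exact ⟨aux s hs, aux (1 - s) ⟨by linarith [hs.2], by linarith [hs.1]⟩⟩

/-- Division of `p + n m` by its gcd `d` gives a primitive vector in the class of `d⁻¹ p`, with norm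
multiplied by `n/d` relative to that of `p/n + m`. -/
lemma ncard_gcd_eq_fiber {n : ℕ} (hn : 0 < n) {p : ℤ × ℤ} {d : ℕ} (hd0 : 0 < d) {e : ℤ}
    (he : d * e ≡ 1 [ZMOD n]) (T : ℝ) :
    (latticeDisc ((p.1 : ℝ) / n, (p.2 : ℝ) / n) T ∩
      {m | Int.gcd (p.1 + n * m.1) (p.2 + n * m.2) = d}).ncard =
    (latticeDisc 0 (n / d * T) ∩
      (primitiveVectors ∩ residueClass n (e * p.1, e * p.2))).ncard := by
  have hn0 : (0 : ℝ) < n := by exact_mod_cast hn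
  have hdr : (0 : ℝ) < d := by exact_mod_cast hd0
  have hdz : (d : ℤ) ≠ 0 := by exact_mod_cast hd0.ne'
  have hnz : (n : ℤ) ≠ 0 := by exact_mod_cast hn.ne'
  have hdisc : ∀ a b x y : ℤ, p.1 + n * a = d * x → p.2 + n * b = d * y →
      ((a, b) ∈ latticeDisc ((p.1 : ℝ) / n, (p.2 : ℝ) / n) T ↔
        (x, y) ∈ latticeDisc 0 (n / d * T)) := by
    intro a b x y h1 h2
    have r1 : (p.1 + n * a : ℝ) = d * x := by exact_mod_cast h1
    have r2 : (p.2 + n * b : ℝ) = d * y := by exact_mod_cast h2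
    rw [mem_latticeDisc_zero]
    simp only [latticeDisc, Set.mem_ofPred_eq]
    have e1 : (a + (p.1 : ℝ) / n) = d / n * x := by field_simp; linarith
    have e2 : (b + (p.2 : ℝ) / n) = d / n * y := by field_simp; linarith
    rw [e1, e2, mul_pow, mul_pow, mul_pow, ← mul_add, div_pow, div_pow, div_mul_eq_mul_div,
      div_mul_eq_mul_div, div_lt_iff₀ (by positivity), lt_div_iff₀ (by positivity)]
    constructor <;> intro h <;> linarith
  refine Set.ncard_congr (fun m _ => ((p.1 + n * m.1) / d, (p.2 + n * m.2) / d)) ?_ ?_ ?_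
  · rintro ⟨a, b⟩ ⟨hm, hg⟩
    have hg' : Int.gcd (p.1 + n * a) (p.2 + n * b) = d := hg
    obtain ⟨x, hx⟩ : (d : ℤ) ∣ p.1 + n * a := hg' ▸ Int.gcd_dvd_left ..
    obtain ⟨y, hy⟩ : (d : ℤ) ∣ p.2 + n * b := hg' ▸ Int.gcd_dvd_right ..
    simp only [hx, hy, Int.mul_ediv_cancel_left _ hdz]
    have hres : ∀ x q a : ℤ, q + n * a = d * x → x ≡ e * q [ZMOD n] := by
      intro x q a h
      obtain ⟨j, hj⟩ := he.dvd
      refine Int.modEq_iff_dvd.2 ⟨-e * a - j * x, ?_⟩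
      linear_combination e * h - x * hj
    refine ⟨(hdisc a b x y hx hy).1 hm, ?_, hres x _ a hx, hres y _ b hy⟩
    rw [hx, hy, Int.gcd_mul_left, Int.natAbs_natCast] at hg'
    exact Nat.eq_of_mul_eq_mul_left hd0 (by rw [hg', mul_one])
  · rintro ⟨a, b⟩ ⟨a', b'⟩ ⟨_, hg⟩ ⟨_, hg'⟩ h
    have hg1 : Int.gcd (p.1 + n * a) (p.2 + n * b) = d := hg
    have hg2 : Int.gcd (p.1 + n * a') (p.2 + n * b') = d := hg'
    simp only [Prod.mk.injEq] at h ⊢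
    have h1 := (Int.ediv_left_inj (hg1 ▸ Int.gcd_dvd_left ..) (hg2 ▸ Int.gcd_dvd_left ..)).1 h.1
    have h2 := (Int.ediv_left_inj (hg1 ▸ Int.gcd_dvd_right ..) (hg2 ▸ Int.gcd_dvd_right ..)).1 h.2
    exact ⟨mul_left_cancel₀ hnz (add_left_cancel h1), mul_left_cancel₀ hnz (add_left_cancel h2)⟩
  · rintro ⟨x, y⟩ ⟨hxy, hprim, h1, h2⟩
    have hex : ∀ x q : ℤ, x ≡ e * q [ZMOD n] → ∃ a : ℤ, q + n * a = d * x := by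
      intro x q h
      obtain ⟨j, hj⟩ := he.dvd
      obtain ⟨i, hi⟩ := h.dvd
      exact ⟨-d * i - j * q, by linear_combination d * hi + q * hj⟩
    obtain ⟨a, ha⟩ := hex x _ h1
    obtain ⟨b, hb⟩ := hex y _ h2
    have hprim' : Int.gcd x y = 1 := hprim
    refine ⟨(a, b), ⟨(hdisc a b x y ha hb).2 hxy, ?_⟩, ?_⟩
    · simp only [Set.mem_ofPred_eq]
      rw [ha, hb, Int.gcd_mul_left, hprim', mul_one, Int.natAbs_natCast]
    · simp only [ha, hb, Int.mul_ediv_cancel_left _ hdz]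

/-- Visible shifts are sorted by `d = gcd(p + n m)`, which runs over the integers below `n` coprime
to `n`; the enlarged radius `n T / d` produces the factor `(n/d)²`. -/
lemma tendsto_ncard_visible_torsion {n : ℕ} (hn : 2 ≤ n) {p : ℤ × ℤ}
    (hp : Nat.gcd (Int.gcd p.1 p.2) n = 1) :
    Tendsto (fun T : ℝ => ((latticeDisc (torsionVector n p 0, torsionVector n p 1) T ∩
      visibleShifts (torsionVector n p)).ncard : ℝ) / T ^ 2) atTop
      (𝓝 (∑ d ∈ (Finset.Ico 1 n).filter (fun i => Nat.gcd i n = 1),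
        primitiveDensity n * ((n : ℝ) / d) ^ 2)) := by
  have hn0 : 0 < n := by omega
  have hset : ∀ T : ℝ, latticeDisc (torsionVector n p 0, torsionVector n p 1) T ∩
      visibleShifts (torsionVector n p) =
      ⋃ d ∈ (Finset.Ico 1 n).filter (fun i => Nat.gcd i n = 1),
        latticeDisc ((p.1 : ℝ) / n, (p.2 : ℝ) / n) T ∩
          {m | Int.gcd (p.1 + n * m.1) (p.2 + n * m.2) = d} := by
    intro T
    ext m
    obtain ⟨h1, h2, h3⟩ := visible_torsion_iff hn hp m
    simp only [Set.mem_inter_iff, h1, Set.mem_iUnion, Finset.mem_filter, Finset.mem_Ico,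
      Set.mem_ofPred_eq, exists_prop, torsionVector_zero, torsionVector_one]
    constructor
    · rintro ⟨hm, hlt⟩
      exact ⟨_, ⟨⟨h2, hlt⟩, h3⟩, hm, rfl⟩
    · rintro ⟨d, ⟨⟨_, hlt⟩, _⟩, hm, rfl⟩
      exact ⟨hm, hlt⟩
  have hlim : ∀ d ∈ (Finset.Ico 1 n).filter (fun i => Nat.gcd i n = 1),
      Tendsto (fun T : ℝ => ((latticeDisc ((p.1 : ℝ) / n, (p.2 : ℝ) / n) T ∩
          {m | Int.gcd (p.1 + n * m.1) (p.2 + n * m.2) = d}).ncard : ℝ) / T ^ 2) atTop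
        (𝓝 (primitiveDensity n * ((n : ℝ) / d) ^ 2)) := by
    intro d hd
    simp only [Finset.mem_filter, Finset.mem_Ico] at hd
    obtain ⟨e, he⟩ : ∃ e : ℤ, d * e ≡ 1 [ZMOD n] := Int.mod_coprime hd.2
    have hco : IsCoprime e n := by
      obtain ⟨j, hj⟩ := he.dvd
      exact ⟨d, j, by linear_combination -hj⟩
    have hd0 : (0 : ℝ) < d := by exact_mod_cast hd.1.1
    have hn' : (0 : ℝ) < n := by exact_mod_cast hn0
    have h := (ncard_primitive_residueClass_tendsto hn0 (c := (e * p.1, e * p.2))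
      (gcd_mul_gcd_eq_one hp hco)).comp
      (tendsto_id.const_mul_atTop (by positivity : (0 : ℝ) < n / d))
    refine (h.mul_const (((n : ℝ) / d) ^ 2)).congr' ?_
    filter_upwards [eventually_gt_atTop 0] with T hT
    rw [ncard_gcd_eq_fiber hn0 hd.1.1 he]
    simp only [Function.comp, id]
    field_simp
  refine (tendsto_finsetSum _ hlim).congr fun T => ?_
  rw [hset, ncard_biUnion_finset, Nat.cast_sum, Finset.sum_div]
  · exact fun d _ => (latticeDisc_finite _ _).inter_of_left _
  · intro k _ l _ hkl
    exact Set.disjoint_left.2 fun v h h' => hkl (h.2.symm.trans h'.2)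

lemma torusProj_torsionVector_ne_zero {n : ℕ} (hn : 2 ≤ n) {p : ℤ × ℤ}
    (hp : Nat.gcd (Int.gcd p.1 p.2) n = 1) : torusProj (torsionVector n p) ≠ 0 := by
  intro h
  have hn0 : (n : ℝ) ≠ 0 := by exact_mod_cast (by omega : n ≠ 0)
  obtain ⟨m, hm⟩ := torusProj_eq_zero_iff.1 h
  have h1 := congrArg (fun v : EuclideanSpace ℝ (Fin 2) => v 0) hm
  have h2 := congrArg (fun v : EuclideanSpace ℝ (Fin 2) => v 1) hm
  simp only [torsionVector_zero, torsionVector_one, intVec_apply_zero, intVec_apply_one] at h1 h2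
  rw [div_eq_iff hn0] at h1 h2
  have d1 : (n : ℤ) ∣ p.1 := ⟨m.1, by rw [mul_comm]; exact_mod_cast h1⟩
  have d2 : (n : ℤ) ∣ p.2 := ⟨m.2, by rw [mul_comm]; exact_mod_cast h2⟩
  have := Nat.dvd_gcd (Int.dvd_gcd d1 d2) dvd_rfl
  rw [hp, Nat.dvd_one] at this
  omega

lemma tendsto_Nsc_torsion {n : ℕ} (hn : 2 ≤ n) {p : ℤ × ℤ}
    (hp : Nat.gcd (Int.gcd p.1 p.2) n = 1) :
    Tendsto (fun T : ℝ => (Nsc (torusProj (torsionVector n p)) T : ℝ) / T ^ 2) atTop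
      (𝓝 (saddleRate n)) := by
  have hn0 : (n : ℝ) ≠ 0 := by exact_mod_cast (by omega : n ≠ 0)
  convert tendsto_Nsc (torusProj_torsionVector_ne_zero hn hp)
    (tendsto_ncard_aligned_torsion (by omega) hp) (tendsto_ncard_visible_torsion hn hp) using 2
  have h : ∑ d ∈ (Finset.Ico 1 n).filter (fun i => Nat.gcd i n = 1),
        primitiveDensity n * ((n : ℝ) / d) ^ 2 =
      primitiveDensity n * (n : ℝ) ^ 2 * coprimeSum n := by
    rw [coprimeSum, Finset.mul_sum]
    exact Finset.sum_congr rfl fun d _ => by ring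
  rw [h, saddleRate, primitiveDensity]
  change _ = 6 / Real.pi - n.totient * (6 / Real.pi / (n : ℝ) ^ 2 * (primeProduct n)⁻¹) +
    6 / Real.pi / (n : ℝ) ^ 2 * (primeProduct n)⁻¹ * (n : ℝ) ^ 2 * coprimeSum n
  field_simp
  ring

lemma tendsto_Npo_torsion {n : ℕ} (hn : 2 ≤ n) {p : ℤ × ℤ}
    (hp : Nat.gcd (Int.gcd p.1 p.2) n = 1) :
    Tendsto (fun T : ℝ => (Npo (torusProj (torsionVector n p)) T : ℝ) / T ^ 2) atTop
      (𝓝 (cylinderRate n)) := by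
  convert tendsto_Npo (tendsto_ncard_aligned_torsion (by omega) hp) using 2
  rw [cylinderRate, primitiveDensity, primeProduct]
  ring

lemma tendsto_Nsc_of_nonrational {x : Torus} (hx : ¬ IsRationalPoint x) :
    Tendsto (fun T : ℝ => (Nsc x T : ℝ) / T ^ 2) atTop (𝓝 (6 / Real.pi + Real.pi)) := by
  obtain ⟨X, rfl⟩ := torusProj_surjective x
  have hX : torusProj X ≠ 0 := by
    intro h
    refine hx (isRationalPoint_of_nsmul_eq_zero one_pos ?_)
    rw [h, smul_zero]
  have h := tendsto_Nsc hX (tendsto_ncard_aligned_of_nonrational hx)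
    (tendsto_ncard_visible_of_nonrational hx)
  rwa [sub_zero] at h

lemma tendsto_Npo_of_nonrational {x : Torus} (hx : ¬ IsRationalPoint x) :
    Tendsto (fun T : ℝ => (Npo x T : ℝ) / T ^ 2) atTop (𝓝 (6 / Real.pi)) := by
  have h := tendsto_Npo (tendsto_ncard_aligned_of_nonrational hx)
  rwa [zero_div, sub_zero] at h

/-! ### Continuity at non-rational points and conclusion -/

/-- Torsion points of order below `N` are killed by `N!`, which is a closed condition failing at
`x`. On a neighbourhood of `x` every rational point therefore has order at least `N`, and its value
is `r n` with `n ≥ N`. -/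
lemma continuousAt_of_tendsto_torsion {f : Torus → ℝ} {r : ℕ → ℝ} {c : ℝ}
    (hr : Tendsto r atTop (𝓝 c)) (hf : ∀ x, ¬ IsRationalPoint x → f x = c)
    (hfr : ∀ (n : ℕ) (p : ℤ × ℤ), 2 ≤ n → Nat.gcd (Int.gcd p.1 p.2) n = 1 →
      f (torusProj (torsionVector n p)) = r n)
    {x : Torus} (hx : ¬ IsRationalPoint x) : ContinuousAt f x := by
  rw [ContinuousAt, hf x hx, Metric.tendsto_nhds]
  intro ε hε
  obtain ⟨N, hN⟩ := Metric.tendsto_atTop.1 hr ε hε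
  have hopen : IsOpen {y : Torus | N.factorial • y ≠ 0} :=
    isOpen_ne.preimage (continuous_const_smul N.factorial)
  have hmem : x ∈ {y : Torus | N.factorial • y ≠ 0} := fun h =>
    hx (isRationalPoint_of_nsmul_eq_zero N.factorial_pos h)
  filter_upwards [hopen.mem_nhds hmem] with y hy
  by_cases hrat : IsRationalPoint y
  · have hy0 : y ≠ 0 := by
      rintro rfl
      exact hy (smul_zero _)
    obtain ⟨n, p, hn, hp, hyp⟩ := exists_torsion_representation hrat hy0
    have hyp' : y = torusProj (torsionVector n p) := hyp
    have hNn : N ≤ n := by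
      by_contra hlt
      obtain ⟨k, hk⟩ := Nat.dvd_factorial (by omega : 0 < n) (not_le.1 hlt).le
      refine hy ?_
      have hn0 : (n : ℝ) ≠ 0 := by exact_mod_cast (by omega : n ≠ 0)
      have htors : n • y = 0 := by
        have h : n • torusProj (torsionVector n p) = torusProj (intVec p) := by
          ext i
          simp only [Pi.smul_apply, torusProj_apply]
          rw [← AddCircle.coe_nsmul, nsmul_eq_mul]
          congr 1
          fin_cases i
          · exact mul_div_cancel₀ _ hn0
          · exact mul_div_cancel₀ _ hn0
        rw [hyp', h, torusProj_intVec]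
      rw [hk, mul_comm, mul_smul, htors, smul_zero]
    rw [hyp', hfr n p hn hp]
    exact hN n hNn
  · rw [hf y hrat, dist_self]
    exact hε

lemma exists_tendsto (x : Torus) :
    (∃ a, Tendsto (fun T : ℝ => (Nsc x T : ℝ) / T ^ 2) atTop (𝓝 a) ∧
      a ≤ 6 / Real.pi + Real.pi ∧ (IsRationalPoint x → a < 6 / Real.pi + Real.pi)) ∧
    (∃ b, Tendsto (fun T : ℝ => (Npo x T : ℝ) / T ^ 2) atTop (𝓝 b) ∧
      b ≤ 6 / Real.pi ∧ (IsRationalPoint x → b < 6 / Real.pi)) := by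
  have hpi := Real.pi_pos
  by_cases hx : IsRationalPoint x
  · by_cases h0 : x = 0
    · subst h0
      have h : 3 / Real.pi < 6 / Real.pi := by gcongr; norm_num
      exact ⟨⟨_, tendsto_Nsc_zero, by linarith, fun _ => by linarith⟩,
        ⟨_, tendsto_Npo_zero, h.le, fun _ => h⟩⟩
    · obtain ⟨n, p, hn, hp, rfl⟩ := exists_torsion_representation hx h0
      have : NeZero n := ⟨by omega⟩
      exact ⟨⟨_, tendsto_Nsc_torsion hn hp, (saddleRate_lt n).le, fun _ => saddleRate_lt n⟩,
        ⟨_, tendsto_Npo_torsion hn hp, (cylinderRate_lt n).le, fun _ => cylinderRate_lt n⟩⟩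
  · exact ⟨⟨_, tendsto_Nsc_of_nonrational hx, le_rfl, fun h => absurd h hx⟩,
      ⟨_, tendsto_Npo_of_nonrational hx, le_rfl, fun h => absurd h hx⟩⟩

theorem mainTheorem1 :
    -- the objects counted are finite in number
    (∀ (x : Torus) (T : ℝ), (saddleConnections x T).Finite ∧ (periodicCylinders x T).Finite) ∧
    -- the quadratic growth rates exist for every marking
    ∃ csc cpo : Torus → ℝ,
      (∀ x : Torus, Filter.Tendsto (fun T : ℝ => (Nsc x T : ℝ) / T ^ 2) Filter.atTop
        (nhds (csc x))) ∧
      (∀ x : Torus, Filter.Tendsto (fun T : ℝ => (Npo x T : ℝ) / T ^ 2) Filter.atTop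
        (nhds (cpo x))) ∧
      -- values at non-rational points
      (∀ x : Torus, ¬ IsRationalPoint x →
        csc x = 6 / Real.pi + Real.pi ∧ cpo x = 6 / Real.pi) ∧
      -- these are the maximal values, and they are not attained at rational points
      (∀ x : Torus, csc x ≤ 6 / Real.pi + Real.pi ∧ cpo x ≤ 6 / Real.pi) ∧
      (∀ x : Torus, IsRationalPoint x →
        csc x < 6 / Real.pi + Real.pi ∧ cpo x < 6 / Real.pi) ∧
      -- values at the rational points different from the origin
      (∀ (n : ℕ) (p₁ p₂ : ℤ), 2 ≤ n → Nat.gcd (Int.gcd p₁ p₂) n = 1 →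
        csc (torusProj !₂[(p₁ : ℝ) / n, (p₂ : ℝ) / n]) =
          6 / Real.pi * (1 + (∏ p ∈ n.primeFactors, (1 - 1 / (p : ℝ) ^ 2))⁻¹ *
            ∑ i ∈ (Finset.Ico 1 n).filter (fun i => Nat.gcd i n = 1),
              (1 / (i : ℝ) ^ 2 - 1 / (n : ℝ) ^ 2)) ∧
        csc (torusProj !₂[(p₁ : ℝ) / n, (p₂ : ℝ) / n]) =
          6 / Real.pi * (1 + (∏ p ∈ n.primeFactors, (1 - 1 / (p : ℝ) ^ 2))⁻¹ *
            ((∑ i ∈ (Finset.Ico 1 n).filter (fun i => Nat.gcd i n = 1), 1 / (i : ℝ) ^ 2)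
              - (Nat.totient n : ℝ) / (n : ℝ) ^ 2)) ∧
        cpo (torusProj !₂[(p₁ : ℝ) / n, (p₂ : ℝ) / n]) =
          6 / Real.pi * (1 - 1 / (2 * (n : ℝ)) *
            (∏ p ∈ n.primeFactors, (1 + 1 / (p : ℝ)))⁻¹) ∧
        cpo (torusProj !₂[(p₁ : ℝ) / n, (p₂ : ℝ) / n]) =
          6 / Real.pi * (1 - (Nat.totient n : ℝ) / (2 * (n : ℝ) ^ 2) *
            (∏ p ∈ n.primeFactors, (1 - 1 / (p : ℝ) ^ 2))⁻¹)) ∧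
      -- continuity at non-rational points
      (∀ x : Torus, ¬ IsRationalPoint x → ContinuousAt csc x ∧ ContinuousAt cpo x) ∧
      (∀ (x : Torus) (xs : ℕ → Torus), ¬ IsRationalPoint x → (∀ k, IsRationalPoint (xs k)) →
        Filter.Tendsto xs Filter.atTop (nhds x) →
        Filter.Tendsto (fun k => csc (xs k)) Filter.atTop (nhds (6 / Real.pi + Real.pi)) ∧
        Filter.Tendsto (fun k => cpo (xs k)) Filter.atTop (nhds (6 / Real.pi))) := by
  refine ⟨fun x T => ⟨saddleConnections_finite x T, periodicCylinders_finite x T⟩, ?_⟩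
  -- The two functions are chosen as limits; uniqueness of limits then identifies their values at
  -- non-rational and at torsion points.
  choose csc hcsc hcsc_le hcsc_lt using fun x => (exists_tendsto x).1
  choose cpo hcpo hcpo_le hcpo_lt using fun x => (exists_tendsto x).2
  have hscn : ∀ x, ¬ IsRationalPoint x → csc x = 6 / Real.pi + Real.pi := fun x hx =>
    tendsto_nhds_unique (hcsc x) (tendsto_Nsc_of_nonrational hx)
  have hpon : ∀ x, ¬ IsRationalPoint x → cpo x = 6 / Real.pi := fun x hx =>
    tendsto_nhds_unique (hcpo x) (tendsto_Npo_of_nonrational hx)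
  have hscr : ∀ (n : ℕ) (p : ℤ × ℤ), 2 ≤ n → Nat.gcd (Int.gcd p.1 p.2) n = 1 →
      csc (torusProj (torsionVector n p)) = saddleRate n := fun n p hn hp =>
    tendsto_nhds_unique (hcsc _) (tendsto_Nsc_torsion hn hp)
  have hpor : ∀ (n : ℕ) (p : ℤ × ℤ), 2 ≤ n → Nat.gcd (Int.gcd p.1 p.2) n = 1 →
      cpo (torusProj (torsionVector n p)) = cylinderRate n := fun n p hn hp =>
    tendsto_nhds_unique (hcpo _) (tendsto_Npo_torsion hn hp)
  have hcont : ∀ x : Torus, ¬ IsRationalPoint x → ContinuousAt csc x ∧ ContinuousAt cpo x :=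
    fun x hx => ⟨continuousAt_of_tendsto_torsion tendsto_saddleRate hscn hscr hx,
      continuousAt_of_tendsto_torsion tendsto_cylinderRate hpon hpor hx⟩
  refine ⟨csc, cpo, hcsc, hcpo, fun x hx => ⟨hscn x hx, hpon x hx⟩,
    fun x => ⟨hcsc_le x, hcpo_le x⟩, fun x hx => ⟨hcsc_lt x hx, hcpo_lt x hx⟩, ?_, hcont, ?_⟩
  · intro n p₁ p₂ hn hp
    have h1 := hscr n (p₁, p₂) hn hp
    have h2 := hpor n (p₁, p₂) hn hp
    exact ⟨h1.trans (saddleRate_eq_sum_sub hn), h1, h2.trans (cylinderRate_eq_prod_add hn), h2⟩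
  · intro x xs hx _ hxs
    rw [← hscn x hx, ← hpon x hx]
    exact ⟨(hcont x hx).1.tendsto.comp hxs, (hcont x hx).2.tendsto.comp hxs⟩
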